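/- Let $u_0:\mathbb R^3\to\mathbb R^3$ belong to weak $L^3$, i.e. $u_0\in L^{3,\infty}(\mathbb R^3)$. Let $P_0(\cdot,t)=e^{t\Delta}u_0$ and, for $k\ge 0$, \[ P_{k+1}=P_0-B(P_k,P_k),\qquad B(f,g)(\cdot,t)=\int_0^t e^{(t-s)\Delta}\,\mathbb P\,\nabla\cdot(f\otimes g)(s)\,ds , \] be the Picard iterates of the Navier--Stokes equations $\partial_tu-\Delta u+u\cdot\nabla u+\nabla p=0$, $\nabla\cdot u=0$ on $\mathbb R^3$. Here $\mathbb P$ is the Leray projection, and $e^{\tau\Delta}\mathbb P\nabla\cdot$ acts by convolution with the kernel whose Fourier symbol is $e^{-4\pi^2\tau|\xi|^2}\bigl(\delta_{ij}-\xi_i\xi_j/|\xi|^2\bigr)\,2\pi i\xi_l$. Let $x_0\in\mathbb R^3$, $0<r<R<\infty$, $3<q\le\infty$, and suppose that $u_0|_{B_R(x_0)}\in L^q(B_R(x_0))$. Then for every integer $k\ge 0$ the convolution integrals defining $P_0,\dots,P_k$ converge absolutely for all $x\in\mathbb R^3$ and $t>0$, and \[ P_k\in L^\infty\bigl(0,\infty;L^q(B_r(x_0))\bigr),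 \] that is, $P_k$ is measurable on $(0,\infty)\times B_r(x_0)$ and $\operatorname*{ess\,sup}_{t>0}\|P_k(\cdot,t)\|_{L^q(B_r(x_0))}<\infty$. -/

import Mathlib

open MeasureTheory Set
open scoped ENNReal NNReal FourierTransform

noncomputable section

namespace PicardNS

/-- Three dimensional Euclidean space. -/
abbrev E3 : Type := EuclideanSpace ℝ (Fin 3)

/-- The quasi-norm of the weak Lebesgue (Lorentz) space `L^{p,∞}(μ)`:
`sup_{a > 0} a * μ{|f| > a}^{1/p}`. -/
def weakLpNorm {α F : Type*} [MeasurableSpace α] [NormedAddCommGroup F]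
    (f : α → F) (p : ℝ) (μ : Measure α) : ℝ≥0∞ :=
  ⨆ a : ℝ≥0, (a : ℝ≥0∞) * (μ {x | (a : ℝ) < ‖f x‖}) ^ (1 / p)

/-- Membership in `L^{p,∞}(μ)`. -/
def MemWeakLp {α F : Type*} [MeasurableSpace α] [NormedAddCommGroup F]
    (f : α → F) (p : ℝ) (μ : Measure α) : Prop :=
  AEStronglyMeasurable f μ ∧ weakLpNorm f p μ < ∞

/-- The heat kernel of `∂_t - Δ` on `ℝ³`. -/
def heatKernel (t : ℝ) (z : E3) : ℝ :=
  (4 * Real.pi * t) ^ (-(3 / 2) : ℝ) * Real.exp (-(‖z‖ ^ 2) / (4 * t))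

/-- The heat flow `e^{tΔ} u₀`. -/
def heatFlow (u₀ : E3 → E3) (t : ℝ) (x : E3) : E3 :=
  ∫ y, heatKernel t (x - y) • u₀ y

/-- Fourier symbol `exp(-4π² τ |ξ|²)` of the heat semigroup `e^{τΔ}`
(for the Fourier transform with `exp(-2πi x·ξ)`). -/
def heatSymbol (τ : ℝ) (ξ : E3) : ℂ :=
  Complex.exp (-(4 * (Real.pi : ℂ) ^ 2 * (τ : ℂ) * (‖ξ‖ : ℂ) ^ 2))

/-- Fourier symbol `δ_{ij} - ξ_i ξ_j / |ξ|²` of the Leray projection `ℙ` onto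
divergence free fields. -/
def leraySymbol (i j : Fin 3) (ξ : E3) : ℂ :=
  (if i = j then 1 else 0) - (ξ i : ℂ) * (ξ j : ℂ) / (‖ξ‖ : ℂ) ^ 2

/-- Fourier symbol `2πi ξ_l` of the partial derivative `∂_l`. -/
def derivSymbol (l : Fin 3) (ξ : E3) : ℂ :=
  2 * (Real.pi : ℂ) * Complex.I * (ξ l : ℂ)

/-- The convolution kernel of `e^{τΔ} ℙ_{ij} ∂_l` (the derivative `∂_l` of the Oseen tensor `K_{ij}`),
namely the inverse Fourier transform of its symbol. The symbol is integrable for `τ > 0` and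
takes conjugate values at `ξ` and `-ξ`, so the inverse transform is real valued. -/
def oseenKernel (i j l : Fin 3) (τ : ℝ) (z : E3) : ℝ :=
  (𝓕⁻ (fun ξ : E3 => heatSymbol τ ξ * leraySymbol i j ξ * derivSymbol l ξ) z).re

/-- The kernel of `e^{τΔ} ℙ ∇·` at `z`, contracted with the matrix `a ⊗ b`:
the vector with components `∑_{j,l} (∂_l K_{ij})(z, τ) a_j b_l`. -/
def oseenContract (τ : ℝ) (z a b : E3) : E3 :=
  WithLp.toLp 2 (fun i => ∑ j, ∑ l, oseenKernel i j l τ z * a j * b l)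

/-- The space-time integrand in the definition of `B(f,g)(x,t)`, as a function of `(s,y)`. -/
def duhamelIntegrand (f g : ℝ → E3 → E3) (t : ℝ) (x : E3) (p : ℝ × E3) : E3 :=
  oseenContract (t - p.1) (x - p.2) (f p.1 p.2) (g p.1 p.2)

/-- `B(f,g)(x,t) = ∫_0^t e^{(t-s)Δ} ℙ ∇·(f ⊗ g)(s) ds`. -/
def bilinearB (f g : ℝ → E3 → E3) (t : ℝ) (x : E3) : E3 :=
  ∫ s in Ioo 0 t, ∫ y, duhamelIntegrand f g t x (s, y)

/-- The Picard iterates `P_0 = e^{tΔ}u₀`, `P_{k+1} = P_0 - B(P_k, P_k)`. -/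
def picard (u₀ : E3 → E3) : ℕ → ℝ → E3 → E3
  | 0 => heatFlow u₀
  | k + 1 => fun t x => heatFlow u₀ t x - bilinearB (picard u₀ k) (picard u₀ k) t x

/-- All the integrals that enter `P_0, …, P_k` converge absolutely, at all `x` and all `t > 0`. -/
def PicardConverges (u₀ : E3 → E3) (k : ℕ) : Prop :=
  (∀ t : ℝ, 0 < t → ∀ x : E3, Integrable (fun y => heatKernel t (x - y) • u₀ y)) ∧
  ∀ j < k, ∀ t : ℝ, 0 < t → ∀ x : E3,
    IntegrableOn (duhamelIntegrand (picard u₀ j) (picard u₀ j) t x) (Ioo 0 t ×ˢ univ)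

/-- Membership in `L^∞(0,∞; L^q(S))`: joint measurability on `(0,∞) × S`, and a finite essential
supremum over `t > 0` of `‖v(t)‖_{L^q(S)}`. -/
def MemLinftyLq (v : ℝ → E3 → E3) (q : ℝ≥0∞) (S : Set E3) : Prop :=
  AEStronglyMeasurable (fun p : ℝ × E3 => v p.1 p.2)
    ((volume.restrict (Ioi (0 : ℝ))).prod (volume.restrict S)) ∧
  essSup (fun t => eLpNorm (v t) q (volume.restrict S)) (volume.restrict (Ioi (0 : ℝ))) < ∞

end PicardNS

end

/-! No smallness is needed, since constants may depend on `k`. The iteration propagates three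
bounds, each uniform in `t`: the critical sup bound `|v(t)| ≤ A t^{-1/2}`, a Morrey bound `∫
(|x-y|²+σ)⁻² |v(t,y)|² dy ≤ M σ^{-3/2}`, and an `L^q` bound on every ball of radius `r < R`.

The kernel of `e^{τΔ} ℙ ∇·` is at most `C (|z|²+τ)⁻²` (`exists_abs_oseenKernel_le`), and the heat
kernel is at most `64 √t (|z|²+t)⁻²`. So `B(v,v)` is dominated by `quadMajorant`, quadratic in
`|v|`. Estimating one factor by the sup bound turns it into an average of translates of `|v(s)|`
against a measure whose mass `∫ (t-s)^{-1/2} s^{-1/2} ds` is bounded in `t` (`quadMajorant_le`,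
`duhamelMajorant_univ_le`). Minkowski's inequality then transfers the Morrey bound, and the `L^q`
bound of the part of `v` near the ball.

The far part stays at distance `δ` from the smaller ball, where `τ` may be replaced by `τ+δ²` in the
kernel. The Morrey bound at `σ = τ+δ²` gives `(τ+δ²)^{-3/2}`, integrable in time uniformly in `t`,
hence a bounded contribution. Each step loses some radius, so the induction runs over all `r < R` at
once. At the start, weak `L³` implies the Morrey bound (`morreyBound_of_weakLp`). -/

open SchwartzMap

noncomputable section

namespace PicardNS

/-! ### Pointwise decay of the Oseen kernel -/

/-- The real exponent `-4π²|ξ|²` of the heat symbol at time one. -/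
def gaussExponent (ξ : E3) : ℝ := -(4 * Real.pi ^ 2) * ‖ξ‖ ^ 2

lemma heatSymbol_eq_ofReal (τ : ℝ) (ξ : E3) :
    heatSymbol τ ξ = ((Real.exp (-(4 * Real.pi ^ 2 * τ * ‖ξ‖ ^ 2)) : ℝ) : ℂ) := by
  simp [heatSymbol]

lemma norm_heatSymbol (τ : ℝ) (ξ : E3) :
    ‖heatSymbol τ ξ‖ = Real.exp (-(4 * Real.pi ^ 2 * τ * ‖ξ‖ ^ 2)) := by
  rw [heatSymbol_eq_ofReal, Complex.norm_real, Real.norm_eq_abs, abs_of_pos (Real.exp_pos _)]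

lemma hasTemperateGrowth_gaussExponent : gaussExponent.HasTemperateGrowth := by
  unfold gaussExponent
  fun_prop

lemma exists_pow_mul_exp_neg_sq_le {b : ℝ} (hb : 0 < b) (k : ℕ) :
    ∃ C, ∀ x : ℝ, 0 ≤ x → (1 + x) ^ k * Real.exp (-b * x ^ 2) ≤ C := by
  -- Here `(1+x)^k ≤ k! e^{1+x}`, and `x - b x² ≤ 1/(4b)` by completing the square.
  refine ⟨(k.factorial : ℝ) * Real.exp (1 + 1 / (4 * b)), fun x hx => ?_⟩
  have h1 : (1 + x) ^ k ≤ k.factorial * Real.exp (1 + x) := by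
    have := Real.pow_div_factorial_le_exp (1 + x) (by positivity) k
    rw [div_le_iff₀ (by positivity)] at this
    linarith
  calc (1 + x) ^ k * Real.exp (-b * x ^ 2)
      ≤ k.factorial * Real.exp (1 + x) * Real.exp (-b * x ^ 2) := by gcongr
    _ = k.factorial * Real.exp (1 + x + -b * x ^ 2) := by rw [Real.exp_add (1 + x)]; ring
    _ ≤ _ := by
      refine mul_le_mul_of_nonneg_left (Real.exp_le_exp.2 ?_) (by positivity)
      have := mul_nonneg hb.le (sq_nonneg (x - 1 / (2 * b)))
      have e : b * (x - 1 / (2 * b)) ^ 2 = b * x ^ 2 - x + 1 / (4 * b) := by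
        field_simp; ring
      linarith

lemma gaussian_decay (k n : ℕ) :
    ∃ C : ℝ, ∀ x : E3,
      ‖x‖ ^ k * ‖iteratedFDeriv ℝ n (fun ξ => Real.exp (gaussExponent ξ)) x‖ ≤ C := by
  obtain ⟨m, K, hK, hbd⟩ :=
    hasTemperateGrowth_gaussExponent.norm_iteratedFDeriv_le_uniform n
  obtain ⟨C, hC⟩ := exists_pow_mul_exp_neg_sq_le (b := 4 * Real.pi ^ 2) (by positivity)
    (k + m * n)
  have hC0 : 0 ≤ C := le_trans (by positivity) (hC 0 le_rfl)
  refine ⟨n.factorial * (1 + K) ^ n * C, fun x => ?_⟩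
  -- Faà di Bruno: all derivatives of `exp` equal `exp`, and those of the exponent grow
  -- polynomially. The base `D` carries `1 + K` rather than `K` so that `D ≥ 1`, hence `D ≤ D^i` for
  -- `i ≥ 1`.
  have key := norm_iteratedFDeriv_comp_le (g := Real.exp) (f := gaussExponent) (n := n)
    (N := n) (C := Real.exp (gaussExponent x)) (D := (1 + K) * (1 + ‖x‖) ^ m)
    Real.contDiff_exp (hasTemperateGrowth_gaussExponent.1.of_le (by exact_mod_cast le_top)) le_rfl x
    (fun i _ => by
      rw [norm_iteratedFDeriv_eq_norm_iteratedDeriv, iteratedDeriv_eq_iterate,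
        Real.iter_deriv_exp, Real.norm_eq_abs, abs_of_pos (Real.exp_pos _)])
    (fun i hi1 hi => by
      refine (hbd i hi x).trans ?_
      have h1 : 1 ≤ (1 + ‖x‖) ^ m := one_le_pow₀ (by linarith [norm_nonneg x])
      calc K * (1 + ‖x‖) ^ m ≤ (1 + K) * (1 + ‖x‖) ^ m := by gcongr; linarith
        _ ≤ _ := le_self_pow₀ (one_le_mul_of_one_le_of_one_le (by linarith) h1) (by omega))
  calc ‖x‖ ^ k * ‖iteratedFDeriv ℝ n (fun ξ => Real.exp (gaussExponent ξ)) x‖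
      ≤ (1 + ‖x‖) ^ k * (n.factorial * Real.exp (gaussExponent x)
          * ((1 + K) * (1 + ‖x‖) ^ m) ^ n) := by
        gcongr
        · linarith
        · exact key
    _ = n.factorial * (1 + K) ^ n * ((1 + ‖x‖) ^ (k + m * n)
          * Real.exp (-(4 * Real.pi ^ 2) * ‖x‖ ^ 2)) := by
        rw [mul_pow, pow_add, pow_mul, gaussExponent]; ring
    _ ≤ _ := by gcongr; exact hC _ (norm_nonneg _)

/-- The Gaussian `exp(-4π²|ξ|²)` as a Schwartz function. -/
def gaussianSchwartz : 𝓢(E3, ℝ) where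
  toFun ξ := Real.exp (gaussExponent ξ)
  smooth' := Real.contDiff_exp.comp hasTemperateGrowth_gaussExponent.1
  decay' := gaussian_decay

/-- The product of a function `p` of temperate growth with the heat symbol at time one. -/
def mulGaussian (p : E3 → ℂ) : 𝓢(E3, ℂ) :=
  smulLeftCLM ℂ p (bilinLeftCLM (𝕜 := ℝ) (E := ℝ) (F := ℂ) (G := ℂ)
    (ContinuousLinearMap.lsmul ℝ ℝ)
    (Function.HasTemperateGrowth.const (E := E3) (1 : ℂ)) gaussianSchwartz)

lemma mulGaussian_apply {p : E3 → ℂ} (hp : p.HasTemperateGrowth) (ξ : E3) :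
    mulGaussian p ξ = p ξ * heatSymbol 1 ξ := by
  rw [mulGaussian, smulLeftCLM_apply_apply hp, heatSymbol_eq_ofReal, smul_eq_mul]
  congr 1
  change Real.exp (gaussExponent ξ) • (1 : ℂ) = _
  rw [gaussExponent, Complex.real_smul, mul_one]
  congr 2
  ring

lemma fourierInv_decay {p : E3 → ℂ} (hp : p.HasTemperateGrowth) (k : ℕ) :
    ∃ C, 0 ≤ C ∧ ∀ z, (1 + ‖z‖) ^ k * ‖𝓕⁻ (fun ξ => p ξ * heatSymbol 1 ξ) z‖ ≤ C := by
  have h := SchwartzMap.one_add_le_sup_seminorm_apply (𝕜 := ℝ) (m := (k, 0)) (k := k) (n := 0)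
    le_rfl le_rfl (𝓕⁻ (mulGaussian p))
  have e : ((𝓕⁻ (mulGaussian p) : 𝓢(E3, ℂ)) : E3 → ℂ)
      = 𝓕⁻ (fun ξ => p ξ * heatSymbol 1 ξ) := by
    rw [SchwartzMap.fourierInv_coe]
    congr 1
    ext ξ
    exact mulGaussian_apply hp ξ
  simp only [norm_iteratedFDeriv_zero, e] at h
  exact ⟨_, le_trans (by positivity) (h 0), h⟩

/-- Substitute `ξ ↦ cξ`: homogeneity of `p` contributes `c^{-d}` and the Jacobian `c^{-3}`. -/
lemma fourierInv_scaling {p : E3 → ℂ} {d : ℕ} (hd : ∀ (c : ℝ) (ξ : E3), p (c • ξ) = c ^ d * p ξ)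
    {c : ℝ} (hc : 0 < c) (z : E3) :
    𝓕⁻ (fun ξ => p ξ * heatSymbol (c ^ 2) ξ) z
      = (c : ℂ)⁻¹ ^ (d + 3) * 𝓕⁻ (fun ξ => p ξ * heatSymbol 1 ξ) (c⁻¹ • z) := by
  have hcc : (c : ℂ) ≠ 0 := by exact_mod_cast hc.ne'
  rw [Real.fourierInv_eq', Real.fourierInv_eq']
  have h := Measure.integral_comp_smul (volume : Measure E3)
    (fun ξ : E3 => Complex.exp (↑(2 * Real.pi * inner ℝ ξ (c⁻¹ • z)) * Complex.I) •
      (p ξ * heatSymbol 1 ξ)) c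
  have hf : Module.finrank ℝ E3 = 3 := by simp
  rw [hf, abs_of_pos (by positivity)] at h
  have h2 : ∫ ξ : E3, Complex.exp (↑(2 * Real.pi * inner ℝ (c • ξ) (c⁻¹ • z)) * Complex.I) •
      (p (c • ξ) * heatSymbol 1 (c • ξ)) = (c : ℂ) ^ d *
      ∫ ξ : E3, Complex.exp (↑(2 * Real.pi * inner ℝ ξ z) * Complex.I) •
        (p ξ * heatSymbol (c ^ 2) ξ) := by
    rw [← integral_const_mul]
    congr 1
    ext ξ
    have e1 : inner ℝ (c • ξ) (c⁻¹ • z) = inner ℝ ξ z := by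
      rw [real_inner_smul_left, real_inner_smul_right]; field_simp
    have e2 : heatSymbol 1 (c • ξ) = heatSymbol (c ^ 2) ξ := by
      rw [heatSymbol_eq_ofReal, heatSymbol_eq_ofReal, norm_smul, Real.norm_eq_abs,
        abs_of_pos hc]
      congr 3
      ring
    rw [e1, e2, hd, smul_eq_mul, smul_eq_mul]
    ring
  rw [h2] at h
  rw [Complex.real_smul] at h
  rw [inv_pow, pow_add, mul_inv]
  rw [mul_assoc, ← inv_pow, ← inv_pow, ← Complex.ofReal_inv, ← Complex.ofReal_pow _ 3, inv_pow c 3,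
    ← h, Complex.ofReal_inv, ← mul_assoc, ← mul_pow, inv_mul_cancel₀ hcc, one_pow, one_mul]

/-- Schwartz decay at time one, rescaled by `c = √s`. For degree `2m+1` the scaling factor is
`(√s)^{-2(m+2)}`, which is exactly absorbed by decay of order `2(m+2)`. -/
lemma norm_fourierInv_le {p : E3 → ℂ} {m : ℕ} (hp : p.HasTemperateGrowth)
    (hd : ∀ (c : ℝ) (ξ : E3), p (c • ξ) = c ^ (2 * m + 1) * p ξ) :
    ∃ C, 0 ≤ C ∧ ∀ s, 0 < s → ∀ z, ‖𝓕⁻ (fun ξ => p ξ * heatSymbol s ξ) z‖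
      ≤ C * ((‖z‖ ^ 2 + s) ^ (m + 2))⁻¹ := by
  obtain ⟨C, hC0, hC⟩ := fourierInv_decay hp (2 * (m + 2))
  refine ⟨C, hC0, fun s hs z => ?_⟩
  have hc : 0 < √s := Real.sqrt_pos.2 hs
  have hs2 : √s ^ 2 = s := Real.sq_sqrt hs.le
  have h := fourierInv_scaling hd hc z
  rw [hs2] at h
  rw [h, norm_mul, norm_pow, norm_inv, Complex.norm_real, Real.norm_eq_abs, abs_of_pos hc]
  have h1 := hC ((√s)⁻¹ • z)
  rw [norm_smul, norm_inv, Real.norm_eq_abs, abs_of_pos hc] at h1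
  set F := ‖𝓕⁻ (fun ξ => p ξ * heatSymbol 1 ξ) ((√s)⁻¹ • z)‖
  have hF : 0 ≤ F := norm_nonneg _
  rw [← div_eq_mul_inv, le_div_iff₀ (by positivity)]
  calc (√s)⁻¹ ^ (2 * m + 1 + 3) * F * (‖z‖ ^ 2 + s) ^ (m + 2)
      ≤ (√s)⁻¹ ^ (2 * m + 1 + 3) * F * ((√s + ‖z‖) ^ 2) ^ (m + 2) := by
        gcongr
        nlinarith [norm_nonneg z]
    _ = (1 + (√s)⁻¹ * ‖z‖) ^ (2 * (m + 2)) * F := by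
        have : 1 + (√s)⁻¹ * ‖z‖ = (√s)⁻¹ * (√s + ‖z‖) := by field_simp
        rw [this, mul_pow, ← pow_mul]; ring
    _ ≤ C := h1

lemma heatSymbol_one_smul {c : ℝ} (ξ : E3) :
    heatSymbol 1 (c • ξ) = heatSymbol (c ^ 2) ξ := by
  rw [heatSymbol_eq_ofReal, heatSymbol_eq_ofReal, norm_smul, mul_pow, Real.norm_eq_abs, sq_abs]
  congr 3
  ring

lemma integrable_mul_heatSymbol {p : E3 → ℂ} {d : ℕ} (hp : p.HasTemperateGrowth)
    (hd : ∀ (c : ℝ) (ξ : E3), p (c • ξ) = c ^ d * p ξ) {τ : ℝ} (hτ : 0 < τ) :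
    Integrable (fun ξ => p ξ * heatSymbol τ ξ) := by
  have h1 : Integrable (fun ξ => p ξ * heatSymbol 1 ξ) :=
    (mulGaussian p).integrable.congr (.of_forall fun ξ => mulGaussian_apply hp ξ)
  have hc : √τ ≠ 0 := (Real.sqrt_pos.2 hτ).ne'
  have hcc : (√τ : ℂ) ≠ 0 := by exact_mod_cast hc
  refine ((h1.comp_smul hc).const_mul ((√τ : ℂ) ^ d)⁻¹).congr (.of_forall fun ξ => ?_)
  simp only [hd, heatSymbol_one_smul, Real.sq_sqrt hτ.le]
  field_simp

lemma hasTemperateGrowth_coord (i : Fin 3) :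
    (fun ξ : E3 => (ξ i : ℂ)).HasTemperateGrowth := by
  have h : (fun ξ : E3 => (ξ i : ℂ))
      = (Complex.ofRealCLM ∘L (EuclideanSpace.proj i : E3 →L[ℝ] ℝ) : E3 →L[ℝ] ℂ) := by
    ext; simp
  rw [h]
  exact ContinuousLinearMap.hasTemperateGrowth _

lemma hasTemperateGrowth_derivSymbol (l : Fin 3) : (derivSymbol l).HasTemperateGrowth :=
  (Function.HasTemperateGrowth.const _).mul (hasTemperateGrowth_coord l)

lemma derivSymbol_smul (l : Fin 3) (c : ℝ) (ξ : E3) :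
    derivSymbol l (c • ξ) = c ^ (2 * 0 + 1) * derivSymbol l ξ := by
  simp [derivSymbol]; ring

/-- The symbol `4π² ξ_i ξ_j · 2πi ξ_l` of `-∂_i ∂_j ∂_l`. -/
def cubicSymbol (i j l : Fin 3) (ξ : E3) : ℂ :=
  4 * (Real.pi : ℂ) ^ 2 * (ξ i : ℂ) * (ξ j : ℂ) * derivSymbol l ξ

lemma hasTemperateGrowth_cubicSymbol (i j l : Fin 3) : (cubicSymbol i j l).HasTemperateGrowth :=
  (((Function.HasTemperateGrowth.const _).mul (hasTemperateGrowth_coord i)).mul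
    (hasTemperateGrowth_coord j)).mul (hasTemperateGrowth_derivSymbol l)

lemma cubicSymbol_smul (i j l : Fin 3) (c : ℝ) (ξ : E3) :
    cubicSymbol i j l (c • ξ) = c ^ (2 * 1 + 1) * cubicSymbol i j l ξ := by
  simp [cubicSymbol, derivSymbol]; ring

lemma abs_coord_le (i : Fin 3) (ξ : E3) : |ξ i| ≤ ‖ξ‖ := by
  simpa using PiLp.norm_apply_le ξ i

lemma norm_cubicSymbol_le (i j l : Fin 3) (ξ : E3) :
    ‖cubicSymbol i j l ξ‖ ≤ 4 * Real.pi ^ 2 * ‖ξ‖ ^ 2 * ‖derivSymbol l ξ‖ := by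
  simp only [cubicSymbol, norm_mul, norm_pow, Complex.norm_real, Real.norm_eq_abs,
    abs_of_pos Real.pi_pos, Complex.norm_ofNat]
  have h1 := abs_coord_le i ξ
  have h2 := abs_coord_le j ξ
  calc 4 * Real.pi ^ 2 * |ξ i| * |ξ j| * ‖derivSymbol l ξ‖
      ≤ 4 * Real.pi ^ 2 * ‖ξ‖ * ‖ξ‖ * ‖derivSymbol l ξ‖ := by gcongr
    _ = _ := by ring

lemma exp_heat_eq (ξ : E3) (s : ℝ) : Real.exp (-(4 * Real.pi ^ 2 * s * ‖ξ‖ ^ 2))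
    = Real.exp (-(4 * Real.pi ^ 2 * ‖ξ‖ ^ 2) * s) := by
  congr 1; ring

lemma integrableOn_heatSymbol {ξ : E3} (hξ : ξ ≠ 0) (τ : ℝ) :
    IntegrableOn (fun s => heatSymbol s ξ) (Ioi τ) := by
  have ha : -(4 * Real.pi ^ 2 * ‖ξ‖ ^ 2) < 0 := by
    have := norm_pos_iff.2 hξ
    simp only [neg_neg_iff_pos]; positivity
  have h := (integrableOn_exp_mul_Ioi ha τ).ofReal (𝕜 := ℂ)
  refine h.congr (.of_forall fun s => ?_)
  simp only [heatSymbol_eq_ofReal, exp_heat_eq]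
  rfl

lemma integral_exp_heat {ξ : E3} (hξ : ξ ≠ 0) (τ : ℝ) :
    ∫ s in Ioi τ, Real.exp (-(4 * Real.pi ^ 2 * s * ‖ξ‖ ^ 2))
      = Real.exp (-(4 * Real.pi ^ 2 * τ * ‖ξ‖ ^ 2)) / (4 * Real.pi ^ 2 * ‖ξ‖ ^ 2) := by
  have ha : -(4 * Real.pi ^ 2 * ‖ξ‖ ^ 2) < 0 := by
    have := norm_pos_iff.2 hξ
    simp only [neg_neg_iff_pos]; positivity
  simp only [exp_heat_eq]
  rw [integral_exp_mul_Ioi ha, neg_div_neg_eq]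

lemma integral_heatSymbol {ξ : E3} (hξ : ξ ≠ 0) (τ : ℝ) :
    ∫ s in Ioi τ, heatSymbol s ξ = heatSymbol τ ξ / (4 * (Real.pi : ℂ) ^ 2 * (‖ξ‖ : ℂ) ^ 2) := by
  simp only [heatSymbol_eq_ofReal]
  rw [integral_complex_ofReal, integral_exp_heat hξ]
  push_cast
  rfl

lemma continuous_heatSymbol : Continuous (fun p : E3 × ℝ => heatSymbol p.2 p.1) := by
  unfold heatSymbol; fun_prop

/-- The Fubini hypothesis for `leray_part_eq`. Integrating the heat symbol in time produces
`1/(4π²|ξ|²)`, which cancels the two extra powers of `|ξ|` and leaves the integrable `|derivSymbol|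
· heatSymbol τ`. -/
lemma integrable_cubicSymbol_prod (i j l : Fin 3) {τ : ℝ} (hτ : 0 < τ) (z : E3) :
    Integrable (fun p : E3 × ℝ => Complex.exp (↑(2 * Real.pi * inner ℝ p.1 z) * Complex.I) •
      (cubicSymbol i j l p.1 * heatSymbol p.2 p.1))
      ((volume : Measure E3).prod (volume.restrict (Ioi τ))) := by
  have hc : Continuous (cubicSymbol i j l) := (hasTemperateGrowth_cubicSymbol i j l).1.continuous
  have hd : Continuous (derivSymbol l) := (hasTemperateGrowth_derivSymbol l).1.continuous
  have hcont : Continuous (fun p : E3 × ℝ =>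
      Complex.exp (↑(2 * Real.pi * inner ℝ p.1 z) * Complex.I) •
      (cubicSymbol i j l p.1 * heatSymbol p.2 p.1)) := by
    have := continuous_heatSymbol
    fun_prop
  have hne : ∀ᵐ ξ : E3, ξ ≠ 0 := by simp [ae_iff]
  rw [integrable_prod_iff hcont.aestronglyMeasurable]
  constructor
  · filter_upwards [hne] with ξ hξ
    exact ((integrableOn_heatSymbol hξ τ).const_mul _).const_mul _
  · refine (integrable_mul_heatSymbol (hasTemperateGrowth_derivSymbol l)
      (derivSymbol_smul l) hτ).mono ?_ ?_
    · exact (hcont.norm.stronglyMeasurable.integral_prod_right'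
        (ν := volume.restrict (Ioi τ))).aestronglyMeasurable
    · filter_upwards [hne] with ξ hξ
      have hξ' := norm_pos_iff.2 hξ
      simp only [norm_smul, norm_mul, Complex.norm_exp_ofReal_mul_I, one_mul, norm_heatSymbol]
      rw [integral_const_mul, integral_exp_heat hξ, Real.norm_eq_abs, abs_of_nonneg (by positivity)]
      calc ‖cubicSymbol i j l ξ‖ * (Real.exp (-(4 * Real.pi ^ 2 * τ * ‖ξ‖ ^ 2))
              / (4 * Real.pi ^ 2 * ‖ξ‖ ^ 2))
          ≤ (4 * Real.pi ^ 2 * ‖ξ‖ ^ 2 * ‖derivSymbol l ξ‖)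
            * (Real.exp (-(4 * Real.pi ^ 2 * τ * ‖ξ‖ ^ 2)) / (4 * Real.pi ^ 2 * ‖ξ‖ ^ 2)) := by
              gcongr; exact norm_cubicSymbol_le i j l ξ
        _ = _ := by field_simp

/-- The Leray symbol is not smooth at the origin. Writing `e^{-4π²τ|ξ|²}/|ξ|²` as `4π² ∫_τ^∞
e^{-4π²s|ξ|²} ds` replaces it by a superposition of polynomials times Gaussians, whose transforms
are Schwartz. -/
lemma leray_part_eq (i j l : Fin 3) {τ : ℝ} (hτ : 0 < τ) (z : E3) :
    𝓕⁻ (fun ξ : E3 => heatSymbol τ ξ * leraySymbol i j ξ * derivSymbol l ξ) z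
      = (if i = j then 1 else 0) * 𝓕⁻ (fun ξ => derivSymbol l ξ * heatSymbol τ ξ) z
        - ∫ s in Ioi τ, 𝓕⁻ (fun ξ => cubicSymbol i j l ξ * heatSymbol s ξ) z := by
  have hI := integrable_cubicSymbol_prod i j l hτ z
  have hne : ∀ᵐ ξ : E3, ξ ≠ 0 := by simp [ae_iff]
  have h1 : Integrable (fun ξ => Complex.exp (↑(2 * Real.pi * inner ℝ ξ z) * Complex.I) •
      (derivSymbol l ξ * heatSymbol τ ξ)) := by
    refine (integrable_mul_heatSymbol (hasTemperateGrowth_derivSymbol l)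
      (derivSymbol_smul l) hτ).bdd_mul (c := 1) ?_ ?_
    · exact (by fun_prop : Continuous _).aestronglyMeasurable
    · exact .of_forall fun ξ => (Complex.norm_exp_ofReal_mul_I _).le
  have hswap := integral_integral_swap (f := fun (ξ : E3) (s : ℝ) =>
    Complex.exp (↑(2 * Real.pi * inner ℝ ξ z) * Complex.I) •
      (cubicSymbol i j l ξ * heatSymbol s ξ)) hI
  simp only [Real.fourierInv_eq']
  rw [← hswap, ← integral_const_mul, ← integral_sub (h1.const_mul _) hI.integral_prod_left]
  refine integral_congr_ae ?_
  filter_upwards [hne] with ξ hξ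
  have hξ' : (‖ξ‖ : ℂ) ≠ 0 := by simpa using hξ
  have hpi : (Real.pi : ℂ) ≠ 0 := by simp [Real.pi_ne_zero]
  simp only [smul_eq_mul]
  rw [integral_const_mul, integral_const_mul, integral_heatSymbol hξ, leraySymbol, cubicSymbol]
  field_simp

lemma lintegral_add_rpow_neg {a τ : ℝ} (h : 0 < a + τ) {r : ℝ} (hr : 0 < r) :
    ∫⁻ s in Ioi τ, ENNReal.ofReal ((a + s) ^ (-(r + 1)))
      = ENNReal.ofReal ((a + τ) ^ (-r) / r) := by
  have h1 : ∫⁻ s in Ioi τ, ENNReal.ofReal ((a + s) ^ (-(r + 1)))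
      = ∫⁻ s in Ioi (a + τ), ENNReal.ofReal (s ^ (-(r + 1))) := by
    have := (measurePreserving_add_left (volume : Measure ℝ) a).setLIntegral_comp_emb
      (measurableEmbedding_addLeft a) (fun s => ENNReal.ofReal (s ^ (-(r + 1)))) (Ioi τ)
    simpa [add_comm a τ] using this
  rw [h1, ← ofReal_integral_eq_lintegral_ofReal (integrableOn_Ioi_rpow_of_lt (by linarith) h),
    integral_Ioi_rpow_of_lt (by linarith) h]
  · congr 1
    rw [show -(r + 1) + 1 = -r by ring, neg_div_neg_eq]
  · filter_upwards [ae_restrict_mem measurableSet_Ioi] with s hs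
    exact Real.rpow_nonneg (h.trans hs).le _

/-- The pointwise bound for the kernel of `e^{τΔ} ℙ ∇·`. -/
theorem exists_abs_oseenKernel_le : ∃ C, 0 ≤ C ∧ ∀ i j l τ z, 0 < τ →
    |oseenKernel i j l τ z| ≤ C * ((‖z‖ ^ 2 + τ) ^ 2)⁻¹ := by
  have hA := fun l : Fin 3 => norm_fourierInv_le (m := 0) (hasTemperateGrowth_derivSymbol l)
    (derivSymbol_smul l)
  have hB := fun i j l : Fin 3 => norm_fourierInv_le (m := 1)
    (hasTemperateGrowth_cubicSymbol i j l) (cubicSymbol_smul i j l)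
  choose A hA0 hA using hA
  choose B hB0 hB using hB
  refine ⟨∑ l, A l + ∑ i, ∑ j, ∑ l, B i j l,
    add_nonneg (Finset.sum_nonneg fun l _ => hA0 l) (Finset.sum_nonneg fun i _ =>
      Finset.sum_nonneg fun j _ => Finset.sum_nonneg fun l _ => hB0 i j l), fun i j l τ z hτ => ?_⟩
  have hAl : A l ≤ ∑ l, A l := Finset.single_le_sum (fun l _ => hA0 l) (Finset.mem_univ l)
  have hBl : B i j l ≤ ∑ i, ∑ j, ∑ l, B i j l :=
    ((Finset.single_le_sum (f := fun l => B i j l) (fun l _ => hB0 i j l) (Finset.mem_univ l)).trans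
      (Finset.single_le_sum (f := fun j => ∑ l, B i j l)
        (fun j _ => Finset.sum_nonneg fun l _ => hB0 i j l) (Finset.mem_univ j))).trans
      (Finset.single_le_sum (f := fun i => ∑ j, ∑ l, B i j l)
        (fun i _ => Finset.sum_nonneg fun j _ => Finset.sum_nonneg fun l _ => hB0 i j l)
        (Finset.mem_univ i))
  have hz : 0 < ‖z‖ ^ 2 + τ := by positivity
  -- The cubic part decays like `(|z|²+s)⁻³`; integration over `s > τ` lowers the power to two, that
  -- of the derivative part.
  have hint : ‖∫ s in Ioi τ, 𝓕⁻ (fun ξ => cubicSymbol i j l ξ * heatSymbol s ξ) z‖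
      ≤ B i j l * ((‖z‖ ^ 2 + τ) ^ 2)⁻¹ := by
    have h0 : 0 ≤ B i j l * ((‖z‖ ^ 2 + τ) ^ 2)⁻¹ := mul_nonneg (hB0 i j l) (by positivity)
    rw [← ENNReal.ofReal_le_ofReal_iff h0, ofReal_norm]
    refine (enorm_integral_le_lintegral_enorm _).trans ?_
    calc ∫⁻ s in Ioi τ, ‖𝓕⁻ (fun ξ => cubicSymbol i j l ξ * heatSymbol s ξ) z‖ₑ
        ≤ ∫⁻ s in Ioi τ, ENNReal.ofReal (B i j l) *
            ENNReal.ofReal ((‖z‖ ^ 2 + s) ^ (-((2 : ℝ) + 1))) := by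
          refine setLIntegral_mono' measurableSet_Ioi fun s hs => ?_
          have hs0 : 0 < s := hτ.trans hs
          rw [← ENNReal.ofReal_mul (hB0 i j l), ← ofReal_norm]
          refine ENNReal.ofReal_le_ofReal ((hB i j l s hs0 z).trans_eq ?_)
          rw [Real.rpow_neg (by positivity)]
          rw [show (2 : ℝ) + 1 = ((1 + 2 : ℕ) : ℝ) by norm_num, Real.rpow_natCast]
      _ = ENNReal.ofReal (B i j l) * ENNReal.ofReal ((‖z‖ ^ 2 + τ) ^ (-(2 : ℝ)) / 2) := by
          rw [lintegral_const_mul' _ _ ENNReal.ofReal_ne_top, lintegral_add_rpow_neg hz (by norm_num)]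
      _ ≤ _ := by
          rw [← ENNReal.ofReal_mul (hB0 i j l)]
          refine ENNReal.ofReal_le_ofReal (mul_le_mul_of_nonneg_left ?_ (hB0 i j l))
          rw [Real.rpow_neg hz.le]
          norm_num
          positivity
  rw [oseenKernel, leray_part_eq i j l hτ z]
  refine (Complex.abs_re_le_norm _).trans ((norm_sub_le _ _).trans ?_)
  rw [norm_mul]
  have hδ : ‖(if i = j then 1 else 0 : ℂ)‖ ≤ 1 := by split_ifs <;> simp
  calc _ ≤ 1 * (A l * ((‖z‖ ^ 2 + τ) ^ 2)⁻¹) + B i j l * ((‖z‖ ^ 2 + τ) ^ 2)⁻¹ := by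
        gcongr
        exact hA l τ hτ z
    _ ≤ _ := by
        rw [one_mul, ← add_mul]
        gcongr

/-! ### Heat kernel and the common decay kernel -/

lemma heatKernel_nonneg {t : ℝ} (ht : 0 < t) (z : E3) : 0 ≤ heatKernel t z := by
  unfold heatKernel; positivity

theorem heatKernel_le {t : ℝ} (ht : 0 < t) (z : E3) :
    heatKernel t z ≤ 64 * √t * ((‖z‖ ^ 2 + t) ^ 2)⁻¹ := by
  have hz : 0 < ‖z‖ ^ 2 + t := by positivity
  rw [← div_eq_mul_inv, le_div_iff₀ (by positivity), heatKernel]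
  set x := ‖z‖ ^ 2 / (4 * t) with hx
  have hx0 : 0 ≤ x := by positivity
  have h1 : ‖z‖ ^ 2 + t = t * (1 + 4 * x) := by rw [hx]; field_simp; ring
  -- `1 + 4x ≤ 8(1 + x/2) ≤ 8 e^{x/2}`, squared.
  have h2 : (1 + 4 * x) ^ 2 ≤ 64 * Real.exp x := by
    have h3 := Real.add_one_le_exp (x / 2)
    have h4 : Real.exp x = Real.exp (x / 2) ^ 2 := by rw [← Real.exp_nat_mul]; congr 1; norm_num; ring
    rw [h4]
    nlinarith
  have h5 : (4 * Real.pi * t) ^ (-(3 / 2) : ℝ) ≤ t ^ (-(3 / 2) : ℝ) := by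
    refine Real.rpow_le_rpow_of_nonpos ht ?_ (by norm_num)
    nlinarith [Real.pi_gt_three]
  have h6 : t ^ (-(3 / 2) : ℝ) * t ^ 2 = √t := by
    rw [Real.sqrt_eq_rpow, ← Real.rpow_natCast t 2, ← Real.rpow_add ht]; norm_num
  rw [h1, neg_div, ← hx, Real.exp_neg]
  calc (4 * Real.pi * t) ^ (-(3 / 2) : ℝ) * (Real.exp x)⁻¹ * (t * (1 + 4 * x)) ^ 2
      ≤ t ^ (-(3 / 2) : ℝ) * (Real.exp x)⁻¹ * (t ^ 2 * (64 * Real.exp x)) := by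
        rw [mul_pow]; gcongr
    _ = 64 * (t ^ (-(3 / 2) : ℝ) * t ^ 2) := by
        have := (Real.exp_pos x).ne'
        field_simp
    _ = _ := by rw [h6]

/-- The kernel `(|z|² + τ)⁻²`, which dominates the kernel of `e^{τΔ} ℙ ∇·`. -/
def decayKernel (τ : ℝ) (z : E3) : ℝ≥0∞ := ENNReal.ofReal (((‖z‖ ^ 2 + τ) ^ 2)⁻¹)

lemma measurable_decayKernel_comp {α : Type*} [MeasurableSpace α] {f : α → ℝ} {g : α → E3}
    (hf : Measurable f) (hg : Measurable g) : Measurable (fun a => decayKernel (f a) (g a)) := by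
  unfold decayKernel; fun_prop

lemma decayKernel_le {τ : ℝ} (hτ : 0 < τ) (z : E3) :
    decayKernel τ z ≤ ENNReal.ofReal (τ ^ (-2 : ℝ)) := by
  refine ENNReal.ofReal_le_ofReal ?_
  rw [Real.rpow_neg hτ.le, show (2 : ℝ) = (2 : ℕ) by norm_num, Real.rpow_natCast]
  gcongr
  nlinarith [sq_nonneg ‖z‖]

/-- For `|z| ≥ δ` one has `|z|²+τ+δ² ≤ 2(|z|²+τ)`; squaring costs the factor 4. The added `δ²` keeps
the far field bounded as `τ → 0`. -/
lemma decayKernel_far {τ δ : ℝ} (hτ : 0 < τ) {z : E3} (hδ : 0 < δ) (hz : δ ≤ ‖z‖) :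
    decayKernel τ z ≤ 4 * decayKernel (τ + δ ^ 2) z := by
  rw [decayKernel, decayKernel, show (4 : ℝ≥0∞) = ENNReal.ofReal 4 by simp,
    ← ENNReal.ofReal_mul (by norm_num)]
  refine ENNReal.ofReal_le_ofReal ?_
  rw [← div_eq_mul_inv, inv_eq_one_div, div_le_div_iff₀ (by positivity) (by positivity)]
  have h1 : δ ^ 2 ≤ ‖z‖ ^ 2 := by gcongr
  have h2 : ‖z‖ ^ 2 + (τ + δ ^ 2) ≤ 2 * (‖z‖ ^ 2 + τ) := by linarith
  have h3 : (‖z‖ ^ 2 + (τ + δ ^ 2)) ^ 2 ≤ (2 * (‖z‖ ^ 2 + τ)) ^ 2 := by gcongr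
  linarith

/-- The total mass of `decayKernel 1`. -/
def decayMass : ℝ≥0∞ := ∫⁻ z, decayKernel 1 z

lemma decayMass_lt_top : decayMass < ∞ := by
  have h := (integrable_rpow_neg_one_add_norm_sq (E := E3) (μ := volume) (r := 4)
    (by simp; norm_num)).lintegral_lt_top
  refine lt_of_eq_of_lt (lintegral_congr fun z => ?_) h
  rw [decayKernel, show (-4 / 2 : ℝ) = -((2 : ℕ) : ℝ) by norm_num, Real.rpow_neg (by positivity),
    Real.rpow_natCast, add_comm]

lemma decayKernel_sq {c : ℝ} (hc : 0 < c) (z : E3) :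
    decayKernel (c ^ 2) z = ENNReal.ofReal ((c ^ 4)⁻¹) * decayKernel 1 (c⁻¹ • z) := by
  rw [decayKernel, decayKernel, ← ENNReal.ofReal_mul (by positivity), norm_smul, norm_inv,
    Real.norm_eq_abs, abs_of_pos hc, ← mul_inv]
  congr 2
  field_simp

lemma lintegral_comp_smul_E3 {f : E3 → ℝ≥0∞} (hf : Measurable f) {c : ℝ} (hc : 0 < c) :
    ∫⁻ z, f (c⁻¹ • z) = ENNReal.ofReal (c ^ 3) * ∫⁻ z, f z := by
  have hm : Measurable (fun z : E3 => c⁻¹ • z) := by fun_prop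
  rw [← lintegral_map hf hm, Measure.map_addHaar_smul _ (inv_ne_zero hc.ne'),
    lintegral_smul_measure]
  congr 2
  have : Module.finrank ℝ E3 = 3 := by simp
  rw [this, inv_pow, inv_inv, abs_of_pos (by positivity)]

/-- Scaling by `√τ`: `τ⁻²` from the kernel times `τ^{3/2}` from the volume. -/
lemma lintegral_decayKernel {τ : ℝ} (hτ : 0 < τ) :
    ∫⁻ z, decayKernel τ z = decayMass * ENNReal.ofReal (τ ^ (-(1 / 2) : ℝ)) := by
  have hc : 0 < √τ := Real.sqrt_pos.2 hτ
  have h : ∀ z, decayKernel τ z = ENNReal.ofReal ((√τ ^ 4)⁻¹) * decayKernel 1 ((√τ)⁻¹ • z) := by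
    intro z
    rw [← decayKernel_sq hc, Real.sq_sqrt hτ.le]
  simp only [h]
  rw [lintegral_const_mul' _ _ ENNReal.ofReal_ne_top,
    lintegral_comp_smul_E3 (f := decayKernel 1)
      (measurable_decayKernel_comp measurable_const measurable_id) hc, ← mul_assoc,
    ← ENNReal.ofReal_mul (by positivity), mul_comm, decayMass]
  congr 2
  rw [Real.rpow_neg hτ.le, ← Real.sqrt_eq_rpow]
  field_simp

/-! ### Minkowski's integral inequality -/

section Minkowski

variable {X Y : Type*} [MeasurableSpace X] [MeasurableSpace Y]

/-- Jensen's inequality for an unnormalised measure, by comparing the `L¹` and `L^p` norms; `p = 2`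
is Cauchy–Schwarz. -/
lemma rpow_lintegral_le {ν : Measure Y} {h : Y → ℝ≥0∞} (hh : Measurable h) {p : ℝ} (hp : 1 ≤ p) :
    (∫⁻ y, h y ∂ν) ^ p ≤ ν univ ^ (p - 1) * ∫⁻ y, h y ^ p ∂ν := by
  have hp0 : 0 < p := by linarith
  have h1 := eLpNorm'_le_eLpNorm'_mul_rpow_measure_univ (μ := ν) one_pos hp
    hh.aestronglyMeasurable
  simp only [eLpNorm'_eq_lintegral_enorm, enorm_eq_self, ENNReal.rpow_one, div_one] at h1
  calc (∫⁻ y, h y ∂ν) ^ p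
      ≤ ((∫⁻ y, h y ^ p ∂ν) ^ (1 / p) * ν univ ^ (1 - 1 / p)) ^ p := by gcongr
    _ = _ := by
      rw [ENNReal.mul_rpow_of_nonneg _ _ hp0.le, ← ENNReal.rpow_mul, ← ENNReal.rpow_mul,
        one_div_mul_cancel hp0.ne', ENNReal.rpow_one, mul_comm]
      congr 2
      field_simp

/-- Minkowski's integral inequality for a superposition with a uniform bound. -/
lemma lintegral_rpow_lintegral_le {ν : Measure Y} [SFinite ν] {μ : Measure X} [SFinite μ]
    {H : Y → X → ℝ≥0∞} (hH : Measurable (Function.uncurry H)) {p : ℝ} (hp : 1 ≤ p) {C : ℝ≥0∞}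
    (hC : ∀ᵐ y ∂ν, ∫⁻ x, H y x ^ p ∂μ ≤ C) :
    ∫⁻ x, (∫⁻ y, H y x ∂ν) ^ p ∂μ ≤ ν univ ^ p * C := by
  have hHp : Measurable (Function.uncurry fun y x => H y x ^ p) := hH.pow_const p
  calc ∫⁻ x, (∫⁻ y, H y x ∂ν) ^ p ∂μ
      ≤ ∫⁻ x, ν univ ^ (p - 1) * ∫⁻ y, H y x ^ p ∂ν ∂μ :=
        lintegral_mono fun x => rpow_lintegral_le (hH.comp measurable_prodMk_right) hp
    _ = ν univ ^ (p - 1) * ∫⁻ y, ∫⁻ x, H y x ^ p ∂μ ∂ν := by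
        have hm : Measurable fun x => ∫⁻ y, H y x ^ p ∂ν := hHp.lintegral_prod_left'
        rw [lintegral_const_mul _ hm, lintegral_lintegral_swap hHp.aemeasurable]
    _ ≤ ν univ ^ (p - 1) * (C * ν univ) := by
        gcongr
        exact (lintegral_mono_ae hC).trans_eq (lintegral_const C)
    _ = _ := by
        rw [mul_comm C, ← mul_assoc]
        congr 1
        conv_rhs => rw [show p = (p - 1) + 1 by ring,
          ENNReal.rpow_add_of_nonneg _ _ (by linarith) zero_le_one, ENNReal.rpow_one]

/-- Finite `q` is the preceding inequality. For `q = ∞` Fubini exchanges the two almost-everywhere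
quantifiers. -/
lemma eLpNorm_lintegral_le {ν : Measure Y} [SFinite ν] {μ : Measure X} [SFinite μ]
    {H : Y → X → ℝ≥0∞} (hH : Measurable (Function.uncurry H)) {q : ℝ≥0∞} (hq : 1 ≤ q) {C : ℝ≥0∞}
    (hC : ∀ᵐ y ∂ν, eLpNorm (H y) q μ ≤ C) :
    eLpNorm (fun x => ∫⁻ y, H y x ∂ν) q μ ≤ ν univ * C := by
  rcases eq_or_ne q ∞ with rfl | hq'
  · simp only [eLpNorm_exponent_top] at hC ⊢
    have h1 : ∀ᵐ y ∂ν, ∀ᵐ x ∂μ, H y x ≤ C := by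
      filter_upwards [hC] with y hy
      filter_upwards [enorm_ae_le_eLpNormEssSup (H y) μ] with x hx
      exact hx.trans hy
    have h2 : ∀ᵐ x ∂μ, ∀ᵐ y ∂ν, H y x ≤ C :=
      (Measure.ae_ae_comm (p := fun y x => H y x ≤ C)
        (measurableSet_le hH measurable_const)).1 h1
    refine eLpNormEssSup_le_of_ae_enorm_bound ?_
    filter_upwards [h2] with x hx
    rw [enorm_eq_self, mul_comm]
    exact (lintegral_mono_ae hx).trans_eq (lintegral_const C)
  · have hq0 : q ≠ 0 := (zero_lt_one.trans_le hq).ne'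
    have hp : 1 ≤ q.toReal := by
      rw [← ENNReal.toReal_one]; exact ENNReal.toReal_mono hq' hq
    have hp0 : 0 < q.toReal := by linarith
    simp only [eLpNorm_eq_lintegral_rpow_enorm_toReal hq0 hq', enorm_eq_self] at hC ⊢
    have h1 : ∀ᵐ y ∂ν, ∫⁻ x, H y x ^ q.toReal ∂μ ≤ C ^ q.toReal := by
      filter_upwards [hC] with y hy
      rwa [one_div, ENNReal.rpow_inv_le_iff hp0] at hy
    rw [one_div, ENNReal.rpow_inv_le_iff hp0, ENNReal.mul_rpow_of_nonneg _ _ hp0.le]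
    exact lintegral_rpow_lintegral_le hH hp h1

end Minkowski

/-! ### Time integrals, bounded uniformly in `t` -/

section TimeIntegrals

lemma setLIntegral_Ioo_sub_left (f : ℝ → ℝ≥0∞) (t : ℝ) :
    ∫⁻ s in Ioo 0 t, f (t - s) = ∫⁻ s in Ioo 0 t, f s := by
  have := (Measure.measurePreserving_sub_left (volume : Measure ℝ) t).setLIntegral_comp_emb
    (MeasurableEquiv.subLeft t).measurableEmbedding f (Ioo 0 t)
  simpa using this

lemma lintegral_rpow_neg_half {t : ℝ} (ht : 0 < t) :
    ∫⁻ s in Ioo 0 t, ENNReal.ofReal (s ^ (-(1 / 2) : ℝ)) = ENNReal.ofReal (2 * t ^ (1 / 2 : ℝ)) := by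
  have hi : IntervalIntegrable (fun s : ℝ => s ^ (-(1 / 2) : ℝ)) volume 0 t :=
    intervalIntegral.intervalIntegrable_rpow' (by norm_num)
  rw [setLIntegral_congr Ioo_ae_eq_Ioc, ← ofReal_integral_eq_lintegral_ofReal hi.1,
    ← intervalIntegral.integral_of_le ht.le, integral_rpow (Or.inl (by norm_num))]
  · congr 1
    norm_num
    ring
  · filter_upwards [ae_restrict_mem measurableSet_Ioc] with s hs
    exact Real.rpow_nonneg hs.1.le _

lemma lintegral_sub_rpow_neg_half {t : ℝ} (ht : 0 < t) :
    ∫⁻ s in Ioo 0 t, ENNReal.ofReal ((t - s) ^ (-(1 / 2) : ℝ))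
      = ENNReal.ofReal (2 * t ^ (1 / 2 : ℝ)) := by
  rw [setLIntegral_Ioo_sub_left (fun s => ENNReal.ofReal (s ^ (-(1 / 2) : ℝ))),
    lintegral_rpow_neg_half ht]

/-- The larger of `s` and `τ` is at least `t/2`, so its factor is at most `√2 t^{-1/2}`. -/
lemma rpow_neg_half_mul_le {s τ t : ℝ} (hs : 0 < s) (hτ : 0 < τ) (h : s + τ = t) :
    τ ^ (-(1 / 2) : ℝ) * s ^ (-(1 / 2) : ℝ)
      ≤ 2 * t ^ (-(1 / 2) : ℝ) * (s ^ (-(1 / 2) : ℝ) + τ ^ (-(1 / 2) : ℝ)) := by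
  have ht : 0 < t := by linarith
  have key : ∀ {a : ℝ}, t / 2 ≤ a → a ^ (-(1 / 2) : ℝ) ≤ 2 * t ^ (-(1 / 2) : ℝ) := by
    intro a ha
    calc a ^ (-(1 / 2) : ℝ) ≤ (t / 2) ^ (-(1 / 2) : ℝ) :=
          Real.rpow_le_rpow_of_nonpos (by positivity) ha (by norm_num)
      _ = t ^ (-(1 / 2) : ℝ) * (2 : ℝ) ^ (1 / 2 : ℝ) := by
          rw [Real.div_rpow ht.le (by norm_num), Real.rpow_neg (by norm_num : (0 : ℝ) ≤ 2),
            div_inv_eq_mul]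
      _ ≤ t ^ (-(1 / 2) : ℝ) * 2 := by
          gcongr
          exact Real.rpow_le_self_of_one_le (by norm_num) (by norm_num)
      _ = _ := mul_comm _ _
  have hs' : 0 ≤ s ^ (-(1 / 2) : ℝ) := by positivity
  have hτ' : 0 ≤ τ ^ (-(1 / 2) : ℝ) := by positivity
  have ht' : 0 ≤ t ^ (-(1 / 2) : ℝ) := by positivity
  rcases le_total (t / 2) s with h1 | h1
  · have := key h1
    nlinarith [mul_nonneg ht' hs']
  · have := key (a := τ) (by linarith)
    nlinarith [mul_nonneg ht' hτ']

/-- The exact value is `B(1/2,1/2) = π`; only independence of `t` matters. -/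
lemma lintegral_beta_half_le {t : ℝ} (ht : 0 < t) :
    ∫⁻ s in Ioo 0 t, ENNReal.ofReal ((t - s) ^ (-(1 / 2) : ℝ)) * ENNReal.ofReal (s ^ (-(1 / 2) : ℝ))
      ≤ 8 := by
  calc _ ≤ ∫⁻ s in Ioo 0 t, ENNReal.ofReal (2 * t ^ (-(1 / 2) : ℝ)) *
        (ENNReal.ofReal (s ^ (-(1 / 2) : ℝ)) + ENNReal.ofReal ((t - s) ^ (-(1 / 2) : ℝ))) := by
        refine setLIntegral_mono' measurableSet_Ioo fun s hs => ?_
        have h1 : 0 ≤ s ^ (-(1 / 2) : ℝ) := Real.rpow_nonneg hs.1.le _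
        have h2 : 0 ≤ (t - s) ^ (-(1 / 2) : ℝ) := Real.rpow_nonneg (by linarith [hs.2]) _
        rw [← ENNReal.ofReal_mul h2, ← ENNReal.ofReal_add h1 h2, ← ENNReal.ofReal_mul (by positivity)]
        exact ENNReal.ofReal_le_ofReal
          (rpow_neg_half_mul_le hs.1 (by linarith [hs.2]) (by ring))
    _ = ENNReal.ofReal (2 * t ^ (-(1 / 2) : ℝ) * (2 * t ^ (1 / 2 : ℝ) + 2 * t ^ (1 / 2 : ℝ))) := by
        rw [lintegral_const_mul' _ _ ENNReal.ofReal_ne_top, lintegral_add_left (by fun_prop),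
          lintegral_rpow_neg_half ht, lintegral_sub_rpow_neg_half ht,
          ← ENNReal.ofReal_add (by positivity) (by positivity), ← ENNReal.ofReal_mul (by positivity)]
    _ = _ := by
        have : t ^ (-(1 / 2) : ℝ) * t ^ (1 / 2 : ℝ) = 1 := by
          rw [← Real.rpow_add ht]; norm_num
        rw [show 2 * t ^ (-(1 / 2) : ℝ) * (2 * t ^ (1 / 2 : ℝ) + 2 * t ^ (1 / 2 : ℝ))
          = 8 * (t ^ (-(1 / 2) : ℝ) * t ^ (1 / 2 : ℝ)) by ring, this]
        simp

/-- The shift `a` removes the singularity at `s = t`, and extending the integral to a half-line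
removes the dependence on `t`. -/
lemma lintegral_shifted_le {t a : ℝ} (ha : 0 < a) :
    ∫⁻ s in Ioo 0 t, ENNReal.ofReal ((t - s + a) ^ (-(3 / 2) : ℝ))
      ≤ ENNReal.ofReal (2 * a ^ (-(1 / 2) : ℝ)) := by
  rw [setLIntegral_Ioo_sub_left (fun s => ENNReal.ofReal ((s + a) ^ (-(3 / 2) : ℝ)))]
  calc _ ≤ ∫⁻ s in Ioi 0, ENNReal.ofReal ((a + s) ^ (-((1 / 2 : ℝ) + 1))) := by
        rw [show -((1 / 2 : ℝ) + 1) = -(3 / 2) by norm_num]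
        simp only [add_comm a]
        exact lintegral_mono_set Ioo_subset_Ioi_self
    _ = _ := by
        rw [lintegral_add_rpow_neg (by linarith) (by norm_num)]
        congr 1
        rw [add_zero]; ring

end TimeIntegrals

/-! ### Morrey bounds and the propagated quantities -/

/-- A Morrey type bound: `∫ (|x-y|²+σ)⁻² h(y)² dy ≤ M σ^{-3/2}` for all `x` and `σ > 0`. -/
def MorreyBound (h : E3 → ℝ≥0∞) (M : ℝ≥0∞) : Prop :=
  ∀ x σ, 0 < σ → ∫⁻ y, decayKernel σ (x - y) * h y ^ (2 : ℝ) ≤ M * ENNReal.ofReal (σ ^ (-(3 / 2) : ℝ))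

lemma measure_le_of_weakLpNorm {u : E3 → E3} {a : ℝ} (ha : 0 < a) :
    volume {x | a < ‖u x‖} ≤ weakLpNorm u 3 volume ^ (3 : ℝ) * ENNReal.ofReal (a ^ (-3 : ℝ)) := by
  have h := le_iSup (fun a : ℝ≥0 => (a : ℝ≥0∞) * (volume {x | (a : ℝ) < ‖u x‖}) ^ (1 / 3 : ℝ))
    ⟨a, ha.le⟩
  have h2 : ENNReal.ofReal a * volume {x | a < ‖u x‖} ^ (1 / 3 : ℝ) ≤ weakLpNorm u 3 volume := by
    rw [ENNReal.ofReal_eq_coe_nnreal ha.le]; exact h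
  have h3 := ENNReal.rpow_le_rpow h2 (by norm_num : (0 : ℝ) ≤ 3)
  rw [ENNReal.mul_rpow_of_nonneg _ _ (by norm_num), ← ENNReal.rpow_mul,
    one_div_mul_cancel (by norm_num), ENNReal.rpow_one, ENNReal.ofReal_rpow_of_pos ha] at h3
  calc volume {x | a < ‖u x‖}
      = ENNReal.ofReal (a ^ (3 : ℝ)) * volume {x | a < ‖u x‖} * ENNReal.ofReal (a ^ (-3 : ℝ)) := by
        rw [mul_right_comm, ← ENNReal.ofReal_mul (by positivity), ← Real.rpow_add ha]
        simp
    _ ≤ _ := by gcongr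

/-- Layer cake for the measure `ν` with density the decay kernel. Low levels use the total mass `~
σ^{-1/2}`; high levels use the kernel maximum `σ⁻²` and the weak `L³` tail `a⁻³`. -/
lemma morreyBound_of_weakLp {u : E3 → E3} (hu : Measurable u) :
    MorreyBound (fun y => ‖u y‖ₑ) (2 * (decayMass + weakLpNorm u 3 volume ^ (3 : ℝ))) := by
  intro x σ hσ
  set W := weakLpNorm u 3 volume ^ (3 : ℝ)
  set ν := (volume : Measure E3).withDensity (fun y => decayKernel σ (x - y)) with hν
  have hd : Measurable (fun y => decayKernel σ (x - y)) :=
    measurable_decayKernel_comp measurable_const (by fun_prop)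
  have e1 : ∫⁻ y, decayKernel σ (x - y) * ‖u y‖ₑ ^ (2 : ℝ)
      = ∫⁻ y, ENNReal.ofReal (‖u y‖ ^ (2 : ℝ)) ∂ν := by
    rw [hν, lintegral_withDensity_eq_lintegral_mul _ hd (by fun_prop)]
    refine lintegral_congr fun y => ?_
    rw [Pi.mul_apply, ← ofReal_norm, ENNReal.ofReal_rpow_of_nonneg (norm_nonneg _) (by norm_num)]
  have hν1 : ∀ s, ν s ≤ decayMass * ENNReal.ofReal (σ ^ (-(1 / 2) : ℝ)) := by
    intro s
    refine (measure_mono (subset_univ s)).trans ?_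
    rw [hν, withDensity_apply _ MeasurableSet.univ, setLIntegral_univ,
      lintegral_sub_left_eq_self (fun y => decayKernel σ y) x, lintegral_decayKernel hσ]
  have hν2 : ∀ a, 0 < a → ν {y | a < ‖u y‖}
      ≤ W * ENNReal.ofReal (σ ^ (-2 : ℝ)) * ENNReal.ofReal (a ^ (-3 : ℝ)) := by
    intro a ha
    rw [hν, withDensity_apply _ (measurableSet_lt measurable_const hu.norm)]
    calc _ ≤ ∫⁻ _ in {y | a < ‖u y‖}, ENNReal.ofReal (σ ^ (-2 : ℝ)) :=
          lintegral_mono fun y => decayKernel_le hσ _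
      _ = ENNReal.ofReal (σ ^ (-2 : ℝ)) * volume {y | a < ‖u y‖} := by rw [setLIntegral_const]
      _ ≤ ENNReal.ofReal (σ ^ (-2 : ℝ)) * (W * ENNReal.ofReal (a ^ (-3 : ℝ))) := by
          gcongr; exact measure_le_of_weakLpNorm ha
      _ = _ := by ring
  -- At this level the two estimates of `ν {|u| > a}` have the same power of `σ`.
  set lam := σ ^ (-(1 / 2) : ℝ) with hlam
  have hl : 0 < lam := by positivity
  rw [e1, lintegral_rpow_eq_lintegral_meas_lt_mul ν (.of_forall fun y => norm_nonneg (u y))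
    hu.norm.aemeasurable (by norm_num : (0 : ℝ) < 2), ← Ioc_union_Ioi_eq_Ioi hl.le]
  have hA : ∫⁻ a in Ioc 0 lam, ν {y | a < ‖u y‖} * ENNReal.ofReal (a ^ ((2 : ℝ) - 1))
      ≤ decayMass * ENNReal.ofReal (σ ^ (-(3 / 2) : ℝ)) := by
    calc _ ≤ ∫⁻ a in Ioc 0 lam, (decayMass * ENNReal.ofReal lam) * ENNReal.ofReal lam := by
          refine setLIntegral_mono' measurableSet_Ioc fun a ha => ?_
          gcongr
          · exact hν1 _
          · norm_num; exact ha.2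
      _ = decayMass * ENNReal.ofReal (lam * lam * lam) := by
          rw [setLIntegral_const, Real.volume_Ioc, sub_zero, ENNReal.ofReal_mul (by positivity),
            ENNReal.ofReal_mul hl.le]
          ring
      _ = _ := by
          rw [hlam, ← Real.rpow_add hσ, ← Real.rpow_add hσ]; norm_num
  have hB : ∫⁻ a in Ioi lam, ν {y | a < ‖u y‖} * ENNReal.ofReal (a ^ ((2 : ℝ) - 1))
      ≤ W * ENNReal.ofReal (σ ^ (-(3 / 2) : ℝ)) := by
    calc _ ≤ ∫⁻ a in Ioi lam, (W * ENNReal.ofReal (σ ^ (-2 : ℝ))) *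
            ENNReal.ofReal ((0 + a) ^ (-((1 : ℝ) + 1))) := by
          refine setLIntegral_mono' measurableSet_Ioi fun a ha => ?_
          have ha0 : 0 < a := hl.trans ha
          calc _ ≤ W * ENNReal.ofReal (σ ^ (-2 : ℝ)) * ENNReal.ofReal (a ^ (-3 : ℝ)) *
                ENNReal.ofReal (a ^ ((2 : ℝ) - 1)) := by gcongr; exact hν2 a ha0
            _ = _ := by
                rw [mul_assoc (W * _), ← ENNReal.ofReal_mul (by positivity), ← Real.rpow_add ha0]
                norm_num
      _ = W * ENNReal.ofReal (σ ^ (-2 : ℝ) * (lam ^ (-1 : ℝ))) := by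
          rw [lintegral_const_mul _ (by fun_prop), lintegral_add_rpow_neg (by linarith) one_pos,
            zero_add, div_one, ENNReal.ofReal_mul (by positivity), mul_assoc]
      _ = _ := by
          rw [hlam, ← Real.rpow_mul hσ.le, ← Real.rpow_add hσ]; norm_num
  calc _ ≤ ENNReal.ofReal 2 * (decayMass * ENNReal.ofReal (σ ^ (-(3 / 2) : ℝ))
        + W * ENNReal.ofReal (σ ^ (-(3 / 2) : ℝ))) := by
        gcongr
        exact (lintegral_union_le _ _ _).trans (add_le_add hA hB)
    _ = _ := by
        rw [ENNReal.ofReal_ofNat]; ring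

/-- The scale invariant bounds propagated along the Picard iteration. -/
structure CriticalBound (v : ℝ → E3 → E3) : Prop where
  meas : Measurable (Function.uncurry v)
  sup : ∃ A : ℝ≥0, ∀ t, 0 < t → ∀ x, ‖v t x‖ₑ ≤ A * ENNReal.ofReal (t ^ (-(1 / 2) : ℝ))
  morrey : ∃ M : ℝ≥0, ∀ t, 0 < t → MorreyBound (fun y => ‖v t y‖ₑ) M

/-- A bound for `‖v(t)‖_{L^q(S)}` that is uniform in `t > 0`. -/
def UniformLq (v : ℝ → E3 → E3) (q : ℝ≥0∞) (S : Set E3) : Prop :=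
  ∃ C : ℝ≥0, ∀ t, 0 < t → eLpNorm (v t) q (volume.restrict S) ≤ C

lemma MorreyBound.mono {g h : E3 → ℝ≥0∞} {M : ℝ≥0∞} (hh : MorreyBound h M) (hgh : ∀ y, g y ≤ h y) :
    MorreyBound g M := fun x σ hσ =>
  (lintegral_mono fun y => by gcongr; exact hgh y).trans (hh x σ hσ)

lemma MorreyBound.add {g h : E3 → ℝ≥0∞} {M N : ℝ≥0∞} (hg : MorreyBound g M)
    (hh : MorreyBound h N) (hgm : Measurable g) :
    MorreyBound (fun y => g y + h y) (2 * (M + N)) := by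
  intro x σ hσ
  have hk : Measurable fun y => decayKernel σ (x - y) :=
    measurable_decayKernel_comp measurable_const (by fun_prop)
  calc ∫⁻ y, decayKernel σ (x - y) * (g y + h y) ^ (2 : ℝ)
      ≤ ∫⁻ y, 2 * (decayKernel σ (x - y) * g y ^ (2 : ℝ) +
          decayKernel σ (x - y) * h y ^ (2 : ℝ)) := by
        refine lintegral_mono fun y => ?_
        have := ENNReal.rpow_add_le_mul_rpow_add_rpow (g y) (h y) (by norm_num : (1 : ℝ) ≤ 2)
        calc _ ≤ decayKernel σ (x - y) * (2 ^ ((2 : ℝ) - 1) * (g y ^ (2 : ℝ) + h y ^ (2 : ℝ))) := by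
              gcongr
          _ = _ := by norm_num; ring
    _ = 2 * ((∫⁻ y, decayKernel σ (x - y) * g y ^ (2 : ℝ)) +
          ∫⁻ y, decayKernel σ (x - y) * h y ^ (2 : ℝ)) := by
        rw [lintegral_const_mul' _ _ (by simp), lintegral_add_left (by fun_prop)]
    _ ≤ 2 * (M * ENNReal.ofReal (σ ^ (-(3 / 2) : ℝ)) + N * ENNReal.ofReal (σ ^ (-(3 / 2) : ℝ))) := by
        gcongr
        · exact hg x σ hσ
        · exact hh x σ hσ
    _ = _ := by ring

lemma CriticalBound.sub {v w : ℝ → E3 → E3} (hv : CriticalBound v) (hw : CriticalBound w) :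
    CriticalBound (fun t x => v t x - w t x) := by
  obtain ⟨A, hA⟩ := hv.sup
  obtain ⟨A', hA'⟩ := hw.sup
  obtain ⟨M, hM⟩ := hv.morrey
  obtain ⟨M', hM'⟩ := hw.morrey
  refine ⟨hv.meas.sub hw.meas, ⟨A + A', fun t ht x => ?_⟩, ⟨2 * (M + M'), fun t ht => ?_⟩⟩
  · push_cast
    rw [add_mul]
    exact enorm_sub_le.trans (add_le_add (hA t ht x) (hA' t ht x))
  · push_cast
    exact ((hM t ht).add (hM' t ht) (hv.meas.comp measurable_prodMk_left).enorm).mono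
      fun y => enorm_sub_le

lemma UniformLq.sub {v w : ℝ → E3 → E3} {q : ℝ≥0∞} {S : Set E3} (hq : 1 ≤ q)
    (hvm : Measurable (Function.uncurry v)) (hwm : Measurable (Function.uncurry w))
    (hv : UniformLq v q S) (hw : UniformLq w q S) :
    UniformLq (fun t x => v t x - w t x) q S := by
  obtain ⟨C, hC⟩ := hv
  obtain ⟨C', hC'⟩ := hw
  refine ⟨C + C', fun t ht => ?_⟩
  push_cast
  exact (eLpNorm_sub_le (hvm.comp measurable_prodMk_left).aestronglyMeasurable
    (hwm.comp measurable_prodMk_left).aestronglyMeasurable hq).trans (add_le_add (hC t ht) (hC' t ht))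

lemma norm_sub_ge_of_mem_ball {x₀ x y : E3} {r ρ : ℝ} (hx : x ∈ Metric.ball x₀ r)
    (hy : y ∉ Metric.ball x₀ ρ) : ρ - r ≤ ‖x - y‖ := by
  rw [Metric.mem_ball] at hx hy
  rw [← dist_eq_norm]
  linarith [dist_triangle y x x₀, dist_comm x y]

/-- The far field contribution to a convolution with the decay kernel. -/
lemma MorreyBound.far {h : E3 → ℝ≥0∞} {M : ℝ≥0∞} (hh : MorreyBound h M) {x₀ x : E3} {r ρ τ : ℝ}
    (hrρ : r < ρ) (hτ : 0 < τ) (hx : x ∈ Metric.ball x₀ r) :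
    ∫⁻ y, decayKernel τ (x - y) * ((Metric.ball x₀ ρ)ᶜ.indicator h y) ^ (2 : ℝ)
      ≤ 4 * M * ENNReal.ofReal ((τ + (ρ - r) ^ 2) ^ (-(3 / 2) : ℝ)) := by
  have hδ : 0 < ρ - r := sub_pos.2 hrρ
  calc _ ≤ ∫⁻ y, 4 * (decayKernel (τ + (ρ - r) ^ 2) (x - y) * h y ^ (2 : ℝ)) := by
        refine lintegral_mono fun y => ?_
        by_cases hy : y ∈ Metric.ball x₀ ρ
        · simp [hy]
        · rw [indicator_of_mem (by exact hy), ← mul_assoc]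
          gcongr
          exact decayKernel_far hτ hδ (norm_sub_ge_of_mem_ball hx hy)
    _ ≤ _ := by
        rw [lintegral_const_mul' _ _ (by simp), mul_assoc]
        gcongr
        exact hh x _ (by positivity)

lemma eLpNorm_translate_le (g : E3 → ℝ≥0∞) (hg : Measurable g) (z : E3) (q : ℝ≥0∞) (S : Set E3) :
    eLpNorm (fun x => g (x - z)) q (volume.restrict S) ≤ eLpNorm g q volume :=
  (eLpNorm_restrict_le _ _ _ _).trans_eq
    (eLpNorm_comp_measurePreserving hg.aestronglyMeasurable (measurePreserving_sub_right volume z))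

lemma MorreyBound.translate {h : E3 → ℝ≥0∞} {M : ℝ≥0∞} (hh : MorreyBound h M) (x₀ z : E3) {σ : ℝ}
    (hσ : 0 < σ) : ∫⁻ x, decayKernel σ (x₀ - x) * h (x - z) ^ (2 : ℝ)
      ≤ M * ENNReal.ofReal (σ ^ (-(3 / 2) : ℝ)) := by
  rw [← lintegral_add_right_eq_self _ z]
  refine le_trans (lintegral_mono fun x => ?_) (hh (x₀ - z) σ hσ)
  rw [add_sub_cancel_right, sub_sub, add_comm z]

/-- Superpositions of translates inherit a Morrey bound. -/
lemma MorreyBound.superposition {Y : Type*} [MeasurableSpace Y] {ν : Measure Y} [SFinite ν]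
    {h : Y → E3 → ℝ≥0∞} (hm : Measurable (Function.uncurry h)) {ζ : Y → E3} (hζ : Measurable ζ)
    {M : ℝ≥0∞} (hh : ∀ᵐ y ∂ν, MorreyBound (h y) M) :
    MorreyBound (fun x => ∫⁻ y, h y (x - ζ y) ∂ν) (ν univ ^ (2 : ℝ) * M) := by
  intro x₀ σ hσ
  have hk : Measurable fun y => decayKernel σ (x₀ - y) :=
    measurable_decayKernel_comp measurable_const (by fun_prop)
  have hm2 : Measurable (fun p : Y × E3 => h p.1 (p.2 - ζ p.1)) :=
    hm.comp (measurable_fst.prodMk (measurable_snd.sub (hζ.comp measurable_fst)))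
  -- A Morrey bound controls `L²` norms weighted by the decay kernel over all centres, so
  -- translations preserve it and Minkowski with `p = 2` applies.
  have h1 := lintegral_rpow_lintegral_le (ν := ν)
    (μ := (volume : Measure E3).withDensity fun y => decayKernel σ (x₀ - y))
    (H := fun y x => h y (x - ζ y)) hm2 (by norm_num : (1 : ℝ) ≤ 2)
    (C := M * ENNReal.ofReal (σ ^ (-(3 / 2) : ℝ))) (by
      filter_upwards [hh] with y hy
      have hmy : Measurable (fun x => h y (x - ζ y)) := hm2.comp measurable_prodMk_left
      rw [lintegral_withDensity_eq_lintegral_mul _ hk (hmy.pow_const 2)]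
      exact hy.translate x₀ (ζ y) hσ)
  have hm3 : Measurable (fun x => ∫⁻ y, h y (x - ζ y) ∂ν) :=
    Measurable.lintegral_prod_left' (f := fun p : Y × E3 => h p.1 (p.2 - ζ p.1)) hm2
  rw [lintegral_withDensity_eq_lintegral_mul _ hk (hm3.pow_const 2)] at h1
  rw [mul_assoc]
  exact h1

/-- An `L^q` bound on a ball for a function dominated by a superposition of translates and a
constant. -/
lemma eLpNorm_le_of_superposition {Y : Type*} [MeasurableSpace Y] {ν : Measure Y} [SFinite ν]
    {h : Y → E3 → ℝ≥0∞} (hm : Measurable (Function.uncurry h)) {ζ : Y → E3} (hζ : Measurable ζ)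
    {q : ℝ≥0∞} (hq : 1 ≤ q) {C K : ℝ≥0∞} (hC : ∀ᵐ y ∂ν, eLpNorm (h y) q volume ≤ C) {x₀ : E3}
    {r : ℝ} {f : E3 → E3}
    (hf : ∀ x ∈ Metric.ball x₀ r, ‖f x‖ₑ ≤ ∫⁻ y, h y (x - ζ y) ∂ν + K) :
    eLpNorm f q (volume.restrict (Metric.ball x₀ r))
      ≤ ν univ * C + eLpNorm (fun _ : E3 => K) q (volume.restrict (Metric.ball x₀ r)) := by
  have hm2 : Measurable (fun p : Y × E3 => h p.1 (p.2 - ζ p.1)) :=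
    hm.comp (measurable_fst.prodMk (measurable_snd.sub (hζ.comp measurable_fst)))
  have hpt : ∀ᵐ x ∂volume.restrict (Metric.ball x₀ r),
      ‖f x‖ₑ ≤ ‖(∫⁻ y, h y (x - ζ y) ∂ν) + K‖ₑ := by
    filter_upwards [ae_restrict_mem Metric.isOpen_ball.measurableSet] with x hx
    exact hf x hx
  refine (eLpNorm_mono_enorm_ae hpt).trans ((eLpNorm_add_le ?_ (by fun_prop) hq).trans ?_)
  · exact (Measurable.lintegral_prod_left' hm2).aestronglyMeasurable
  · gcongr
    refine eLpNorm_lintegral_le (H := fun y x => h y (x - ζ y)) hm2 hq ?_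
    filter_upwards [hC] with y hy
    exact (eLpNorm_translate_le (h y) (hm.comp measurable_prodMk_left) (ζ y) q _).trans hy

lemma eLpNorm_const_ball_ne_top {K : ℝ≥0∞} (hK : K ≠ ∞) (q : ℝ≥0∞) (x₀ : E3) (r : ℝ) :
    eLpNorm (fun _ : E3 => K) q (volume.restrict (Metric.ball x₀ r)) ≠ ∞ := by
  have : IsFiniteMeasure ((volume : Measure E3).restrict (Metric.ball x₀ r)) :=
    ⟨by rw [Measure.restrict_apply_univ]; exact measure_ball_lt_top⟩
  exact (memLp_const_enorm (by simpa using hK)).2.ne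

/-! ### Bounds for the heat flow -/

section Heat

/-- The measure `64 √t (|z|² + t)⁻² dz`, which dominates the heat kernel. -/
def heatMajorant (t : ℝ) : Measure E3 :=
  volume.withDensity fun z => ENNReal.ofReal (64 * √t) * decayKernel t z

instance (t : ℝ) : SFinite (heatMajorant t) := by unfold heatMajorant; infer_instance

lemma lintegral_heatMajorant (t : ℝ) {h : E3 → ℝ≥0∞} (hh : Measurable h) (x : E3) :
    ∫⁻ z, h (x - z) ∂heatMajorant t
      = ENNReal.ofReal (64 * √t) * ∫⁻ y, decayKernel t (x - y) * h y := by
  have hk : Measurable (decayKernel t) := measurable_decayKernel_comp measurable_const measurable_id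
  have e := lintegral_sub_left_eq_self (μ := volume)
    (fun y => decayKernel t y * h (x - y)) x
  rw [heatMajorant, lintegral_withDensity_eq_lintegral_mul _ (by fun_prop) (by fun_prop)]
  simp only [sub_sub_cancel] at e
  rw [e, ← lintegral_const_mul' _ _ ENNReal.ofReal_ne_top]
  simp only [Pi.mul_apply, mul_assoc]

/-- The factor `√t` cancels the mass `t^{-1/2}` of the decay kernel. -/
lemma heatMajorant_univ {t : ℝ} (ht : 0 < t) : heatMajorant t univ = 64 * decayMass := by
  rw [heatMajorant, withDensity_apply _ MeasurableSet.univ, setLIntegral_univ,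
    lintegral_const_mul' _ _ ENNReal.ofReal_ne_top, lintegral_decayKernel ht, mul_left_comm,
    ← ENNReal.ofReal_mul (by positivity), Real.sqrt_eq_rpow, mul_assoc, ← Real.rpow_add ht, mul_comm]
  norm_num

lemma lintegral_heatKernel_le {u : E3 → E3} (hu : Measurable u) {t : ℝ} (ht : 0 < t) (x : E3) :
    ∫⁻ y, ‖heatKernel t (x - y) • u y‖ₑ ≤ ∫⁻ z, ‖u (x - z)‖ₑ ∂heatMajorant t := by
  rw [lintegral_heatMajorant t (h := fun y => ‖u y‖ₑ) hu.enorm,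
    ← lintegral_const_mul' _ _ ENNReal.ofReal_ne_top]
  refine lintegral_mono fun y => ?_
  rw [enorm_smul, ← mul_assoc, decayKernel, ← ENNReal.ofReal_mul (by positivity), Real.enorm_eq_ofReal
    (heatKernel_nonneg ht _)]
  gcongr
  exact heatKernel_le ht _

lemma measurable_heatKernel : Measurable (fun p : ℝ × E3 => heatKernel p.1 p.2) := by
  unfold heatKernel; fun_prop

lemma measurable_heatFlow {u : E3 → E3} (hu : Measurable u) :
    Measurable (Function.uncurry (heatFlow u)) := by
  have h : Measurable (fun p : (ℝ × E3) × E3 => heatKernel p.1.1 (p.1.2 - p.2) • u p.2) :=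
    (measurable_heatKernel.comp (f := fun p : (ℝ × E3) × E3 => (p.1.1, p.1.2 - p.2))
      (by fun_prop)).smul (hu.comp measurable_snd)
  exact h.stronglyMeasurable.integral_prod_right'.measurable

/-- Cauchy–Schwarz, to reach the square that a Morrey bound controls. -/
lemma heatMajorant_sq_le {h : E3 → ℝ≥0∞} (hh : Measurable h) {t : ℝ} (ht : 0 < t) (x : E3) :
    ∫⁻ z, h (x - z) ∂heatMajorant t
      ≤ (64 * decayMass * (ENNReal.ofReal (64 * √t) *
          ∫⁻ y, decayKernel t (x - y) * h y ^ (2 : ℝ))) ^ (1 / 2 : ℝ) := by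
  have h1 := rpow_lintegral_le (ν := heatMajorant t) (h := fun z => h (x - z)) (by fun_prop)
    (by norm_num : (1 : ℝ) ≤ 2)
  rw [heatMajorant_univ ht, lintegral_heatMajorant t (h := fun y => h y ^ (2 : ℝ))
    (hh.pow_const _)] at h1
  rw [one_div, ENNReal.le_rpow_inv_iff (by norm_num)]
  norm_num at h1 ⊢
  exact h1

variable {u : E3 → E3} {M : ℝ≥0}

/-- The Morrey bound at `σ = t` gives `(√t · t^{-3/2})^{1/2} = t^{-1/2}`. -/
lemma heatMajorant_sup (hu : Measurable u) (hM : MorreyBound (fun y => ‖u y‖ₑ) M) :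
    ∃ A : ℝ≥0, ∀ t, 0 < t → ∀ x, ∫⁻ z, ‖u (x - z)‖ₑ ∂heatMajorant t
      ≤ A * ENNReal.ofReal (t ^ (-(1 / 2) : ℝ)) := by
  have hfin : (64 * decayMass * (64 * M)) ^ (1 / 2 : ℝ) ≠ ∞ := by
    have := decayMass_lt_top.ne
    exact ENNReal.rpow_ne_top_of_nonneg (by norm_num) (by finiteness)
  refine ⟨((64 * decayMass * (64 * M)) ^ (1 / 2 : ℝ)).toNNReal, fun t ht x => ?_⟩
  rw [ENNReal.coe_toNNReal hfin]
  refine (heatMajorant_sq_le hu.enorm ht x).trans ?_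
  have e : ENNReal.ofReal (t ^ (-(1 / 2) : ℝ)) = ENNReal.ofReal (t⁻¹) ^ (1 / 2 : ℝ) := by
    rw [ENNReal.ofReal_rpow_of_pos (by positivity), Real.inv_rpow ht.le, Real.rpow_neg ht.le]
  rw [e, ← ENNReal.mul_rpow_of_nonneg _ _ (by norm_num : (0 : ℝ) ≤ 1 / 2)]
  refine ENNReal.rpow_le_rpow ?_ (by norm_num)
  calc _ ≤ 64 * decayMass * (ENNReal.ofReal (64 * √t) *
          (M * ENNReal.ofReal (t ^ (-(3 / 2) : ℝ)))) := by gcongr; exact hM x t ht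
    _ = 64 * decayMass * M * ENNReal.ofReal (64 * (√t * t ^ (-(3 / 2) : ℝ))) := by
        rw [← mul_assoc 64 √t, ENNReal.ofReal_mul (p := 64 * √t) (by positivity)]; ring
    _ = _ := by
        rw [Real.sqrt_eq_rpow, ← Real.rpow_add ht, show (1 / 2 + -(3 / 2) : ℝ) = -1 by norm_num,
          Real.rpow_neg_one, ENNReal.ofReal_mul (by norm_num), ENNReal.ofReal_ofNat]
        ring

lemma integrable_heatKernel (hu : Measurable u) (hM : MorreyBound (fun y => ‖u y‖ₑ) M) {t : ℝ}
    (ht : 0 < t) (x : E3) : Integrable (fun y => heatKernel t (x - y) • u y) := by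
  obtain ⟨A, hA⟩ := heatMajorant_sup hu hM
  have hm : Measurable (fun y => heatKernel t (x - y)) :=
    measurable_heatKernel.comp (f := fun y => (t, x - y)) (by fun_prop)
  exact ⟨(hm.smul hu).aestronglyMeasurable, ((lintegral_heatKernel_le hu ht x).trans
    (hA t ht x)).trans_lt (by finiteness)⟩

lemma enorm_heatFlow_le (hu : Measurable u) {t : ℝ} (ht : 0 < t) (x : E3) :
    ‖heatFlow u t x‖ₑ ≤ ∫⁻ z, ‖u (x - z)‖ₑ ∂heatMajorant t :=
  (enorm_integral_le_lintegral_enorm _).trans (lintegral_heatKernel_le hu ht x)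

lemma criticalBound_heatFlow (hu : Measurable u) (hM : MorreyBound (fun y => ‖u y‖ₑ) M) :
    CriticalBound (heatFlow u) := by
  have hmass := decayMass_lt_top.ne
  obtain ⟨A, hA⟩ := heatMajorant_sup hu hM
  refine ⟨measurable_heatFlow hu, ⟨A, fun t ht x => (enorm_heatFlow_le hu ht x).trans (hA t ht x)⟩,
    ⟨((64 * decayMass) ^ (2 : ℝ) * M).toNNReal, fun t ht => ?_⟩⟩
  rw [ENNReal.coe_toNNReal (by finiteness), ← heatMajorant_univ ht]
  refine MorreyBound.mono ?_ (enorm_heatFlow_le hu ht)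
  exact MorreyBound.superposition (h := fun _ y => ‖u y‖ₑ) (ζ := id) (hu.comp measurable_snd).enorm
    measurable_id (.of_forall fun _ => hM)

/-- Data inside `B_R` is averaged in `L^q` by Minkowski; data outside contributes at most a constant
on `B_r`. -/
lemma uniformLq_heatFlow (hu : Measurable u) (hM : MorreyBound (fun y => ‖u y‖ₑ) M)
    {q : ℝ≥0∞} (hq : 1 ≤ q) {x₀ : E3} {r R : ℝ} (hrR : r < R)
    (hloc : MemLp u q (volume.restrict (Metric.ball x₀ R))) :
    UniformLq (heatFlow u) q (Metric.ball x₀ r) := by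
  have hmass := decayMass_lt_top.ne
  have hδ : 0 < R - r := sub_pos.2 hrR
  set S := Metric.ball x₀ R with hS
  have hSm : MeasurableSet S := Metric.isOpen_ball.measurableSet
  -- With `δ = R - r`, the far field involves `√t (t+δ²)^{-3/2} ≤ δ⁻²`, uniformly in `t`.
  set K : ℝ≥0∞ := (64 * decayMass * (64 * (4 * M * ENNReal.ofReal (((R - r) ^ 2)⁻¹)))) ^ (1 / 2 : ℝ)
    with hKdef
  have hK : K ≠ ∞ := ENNReal.rpow_ne_top_of_nonneg (by norm_num) (by finiteness)
  set near : E3 → ℝ≥0∞ := S.indicator fun y => ‖u y‖ₑ with hnear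
  set far : E3 → ℝ≥0∞ := Sᶜ.indicator fun y => ‖u y‖ₑ with hfar
  have hnm : Measurable near := hu.enorm.indicator hSm
  have hfm : Measurable far := hu.enorm.indicator hSm.compl
  have hfarK : ∀ t, 0 < t → ∀ x ∈ Metric.ball x₀ r, ∫⁻ z, far (x - z) ∂heatMajorant t ≤ K := by
    intro t ht x hx
    refine (heatMajorant_sq_le hfm ht x).trans ?_
    refine ENNReal.rpow_le_rpow (mul_le_mul' le_rfl ?_) (by norm_num)
    calc _ ≤ ENNReal.ofReal (64 * √t) * (4 * M *
          ENNReal.ofReal ((t + (R - r) ^ 2) ^ (-(3 / 2) : ℝ))) := by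
          gcongr; exact hM.far hrR ht hx
      _ = 4 * M * ENNReal.ofReal (64 * (√t * (t + (R - r) ^ 2) ^ (-(3 / 2) : ℝ))) := by
          rw [← mul_assoc 64 √t, ENNReal.ofReal_mul (p := 64 * √t) (by positivity)]; ring
      _ ≤ 4 * M * ENNReal.ofReal (64 * ((R - r) ^ 2)⁻¹) := by
          gcongr
          have hp : 0 < t + (R - r) ^ 2 := by positivity
          calc √t * (t + (R - r) ^ 2) ^ (-(3 / 2) : ℝ)
              ≤ √(t + (R - r) ^ 2) * (t + (R - r) ^ 2) ^ (-(3 / 2) : ℝ) := by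
                gcongr; linarith [sq_nonneg (R - r)]
            _ = (t + (R - r) ^ 2)⁻¹ := by
                rw [Real.sqrt_eq_rpow, ← Real.rpow_add hp, ← Real.rpow_neg_one]; norm_num
            _ ≤ _ := by gcongr; linarith
      _ = _ := by
          rw [ENNReal.ofReal_mul (by norm_num), ENNReal.ofReal_ofNat]; ring
  have hC : eLpNorm near q volume ≠ ∞ := by
    rw [hnear, eLpNorm_indicator_eq_eLpNorm_restrict hSm, eLpNorm_enorm]
    exact hloc.2.ne
  have hKS := eLpNorm_const_ball_ne_top hK q x₀ r
  refine ⟨(64 * decayMass * eLpNorm near q volume +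
    eLpNorm (fun _ : E3 => K) q (volume.restrict (Metric.ball x₀ r))).toNNReal, fun t ht => ?_⟩
  rw [ENNReal.coe_toNNReal (by finiteness), ← heatMajorant_univ ht]
  refine eLpNorm_le_of_superposition (h := fun _ => near) (ζ := id) (hnm.comp measurable_snd)
    measurable_id hq (.of_forall fun _ => le_rfl) fun x hx => (enorm_heatFlow_le hu ht x).trans ?_
  calc ∫⁻ z, ‖u (x - z)‖ₑ ∂heatMajorant t
      = ∫⁻ z, near (x - z) + far (x - z) ∂heatMajorant t :=
        lintegral_congr fun z => by
          rw [hnear, hfar]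
          exact (congrFun (indicator_self_add_compl S fun y => ‖u y‖ₑ) (x - z)).symm
    _ ≤ _ := by
        rw [lintegral_add_left (by fun_prop)]
        exact add_le_add le_rfl (hfarK t ht x hx)

end Heat

/-! ### The quadratic majorant of the Duhamel term -/

section Majorant

/-- The measure `(|z|² + t - s)⁻² s^{-1/2} ds dz` on `(0,t) × ℝ³`. -/
def duhamelMajorant (t : ℝ) : Measure (ℝ × E3) :=
  ((volume.restrict (Ioo 0 t)).prod volume).withDensity
    fun p => decayKernel (t - p.1) p.2 * ENNReal.ofReal (p.1 ^ (-(1 / 2) : ℝ))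

instance (t : ℝ) : SFinite (duhamelMajorant t) := by unfold duhamelMajorant; infer_instance

lemma measurable_duhamelDensity (t : ℝ) : Measurable fun p : ℝ × E3 =>
    decayKernel (t - p.1) p.2 * ENNReal.ofReal (p.1 ^ (-(1 / 2) : ℝ)) :=
  (measurable_decayKernel_comp (by fun_prop) measurable_snd).mul (by fun_prop)

lemma lintegral_duhamelMajorant (t : ℝ) {g : ℝ → E3 → ℝ≥0∞} (hg : Measurable (Function.uncurry g))
    (x : E3) : ∫⁻ p, g p.1 (x - p.2) ∂duhamelMajorant t
      = ∫⁻ s in Ioo 0 t, ∫⁻ y, decayKernel (t - s) (x - y) *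
          ENNReal.ofReal (s ^ (-(1 / 2) : ℝ)) * g s y := by
  have hg2 : Measurable fun p : ℝ × E3 => g p.1 (x - p.2) :=
    hg.comp (f := fun p : ℝ × E3 => (p.1, x - p.2)) (by fun_prop)
  have hd := measurable_duhamelDensity t
  rw [duhamelMajorant, lintegral_withDensity_eq_lintegral_mul _ hd hg2,
    lintegral_prod _ (hd.mul hg2).aemeasurable]
  refine lintegral_congr fun s => ?_
  have e := lintegral_sub_left_eq_self (μ := (volume : Measure E3)) (fun z => decayKernel (t - s) z *
    ENNReal.ofReal (s ^ (-(1 / 2) : ℝ)) * g s (x - z)) x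
  simp only [sub_sub_cancel] at e
  rw [e]
  rfl

lemma duhamelMajorant_univ_le {t : ℝ} (ht : 0 < t) : duhamelMajorant t univ ≤ 8 * decayMass := by
  have h := lintegral_duhamelMajorant t (g := fun _ _ => 1) measurable_const 0
  simp only [lintegral_const, one_mul, mul_one] at h
  rw [h]
  calc _ = ∫⁻ s in Ioo 0 t, decayMass * (ENNReal.ofReal ((t - s) ^ (-(1 / 2) : ℝ)) *
        ENNReal.ofReal (s ^ (-(1 / 2) : ℝ))) := by
        refine setLIntegral_congr_fun measurableSet_Ioo fun s hs => ?_
        rw [lintegral_mul_const' _ _ ENNReal.ofReal_ne_top,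
          lintegral_sub_left_eq_self (fun y => decayKernel (t - s) y) 0,
          lintegral_decayKernel (by linarith [hs.2]), mul_assoc]
    _ ≤ _ := by
        rw [lintegral_const_mul' _ _ decayMass_lt_top.ne, mul_comm]
        gcongr
        exact lintegral_beta_half_le ht

/-- The bounds on `v(s)` are available only for `s > 0`; this supplies them almost everywhere in
superpositions. -/
lemma ae_duhamelMajorant (t : ℝ) : ∀ᵐ p ∂duhamelMajorant t, 0 < p.1 := by
  refine (withDensity_absolutelyContinuous _ _).ae_le ?_
  have h : ∀ᵐ s ∂(volume.restrict (Ioo 0 t)), 0 < s := by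
    filter_upwards [ae_restrict_mem measurableSet_Ioo] with s hs using hs.1
  exact Measure.quasiMeasurePreserving_fst.ae h

/-- The quadratic majorant of the Duhamel integral. -/
def quadMajorant (h : ℝ → E3 → ℝ≥0∞) (t : ℝ) (x : E3) : ℝ≥0∞ :=
  ∫⁻ s in Ioo 0 t, ∫⁻ y, decayKernel (t - s) (x - y) * h s y ^ (2 : ℝ)

variable {h : ℝ → E3 → ℝ≥0∞} {A M : ℝ≥0}

/-- One of the two factors is estimated by the sup bound. The result is linear in `h`, so norms that
pass through averages of translates propagate. -/
lemma quadMajorant_le (hm : Measurable (Function.uncurry h))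
    (hA : ∀ s, 0 < s → ∀ x, h s x ≤ A * ENNReal.ofReal (s ^ (-(1 / 2) : ℝ))) (t : ℝ) (x : E3) :
    quadMajorant h t x ≤ ∫⁻ p, A * h p.1 (x - p.2) ∂duhamelMajorant t := by
  rw [lintegral_duhamelMajorant t (g := fun s y => A * h s y) (hm.const_mul _)]
  refine setLIntegral_mono' measurableSet_Ioo fun s hs => lintegral_mono fun y => ?_
  rw [mul_assoc]
  gcongr
  calc h s y ^ (2 : ℝ) = h s y * h s y := by rw [ENNReal.rpow_two, sq]
    _ ≤ (A * ENNReal.ofReal (s ^ (-(1 / 2) : ℝ))) * h s y := by gcongr; exact hA s hs.1 y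
    _ = _ := by ring

lemma morreyBound_quadMajorant (hm : Measurable (Function.uncurry h))
    (hA : ∀ s, 0 < s → ∀ x, h s x ≤ A * ENNReal.ofReal (s ^ (-(1 / 2) : ℝ)))
    (hM : ∀ s, 0 < s → MorreyBound (h s) M) {t : ℝ} (ht : 0 < t) :
    MorreyBound (quadMajorant h t) ((8 * decayMass) ^ (2 : ℝ) * (A ^ (2 : ℝ) * M)) := by
  have hsup := MorreyBound.superposition (ν := duhamelMajorant t)
    (h := fun p y => A * h p.1 y) (ζ := Prod.snd) (M := A ^ (2 : ℝ) * M)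
    ((hm.comp (f := fun p : (ℝ × E3) × E3 => (p.1.1, p.2)) (by fun_prop)).const_mul _)
    measurable_snd (by
      filter_upwards [ae_duhamelMajorant t] with p hp x σ hσ
      calc _ = ∫⁻ y, (A : ℝ≥0∞) ^ (2 : ℝ) * (decayKernel σ (x - y) * h p.1 y ^ (2 : ℝ)) := by
            refine lintegral_congr fun y => ?_
            rw [ENNReal.mul_rpow_of_nonneg _ _ (by norm_num)]; ring
        _ ≤ _ := by
            rw [lintegral_const_mul' _ _ (by finiteness), mul_assoc]
            gcongr
            exact hM p.1 hp x σ hσ)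
  intro x σ hσ
  refine (hsup.mono (quadMajorant_le hm hA t) x σ hσ).trans ?_
  gcongr
  exact duhamelMajorant_univ_le ht

/-- The sup bound on both factors would give `s⁻¹`, not integrable at `s = 0`, so it is used only
for `s ≥ t/2`. For `s ≤ t/2` the Morrey bound at `σ = t - s` is used, with `(t-s)⁻¹ ≤ 2/t`. -/
lemma lintegral_decay_sq_le (hA : ∀ s, 0 < s → ∀ x, h s x ≤ A * ENNReal.ofReal (s ^ (-(1 / 2) : ℝ)))
    (hM : ∀ s, 0 < s → MorreyBound (h s) M) {s t : ℝ} (hs : s ∈ Ioo 0 t) (x : E3) :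
    ∫⁻ y, decayKernel (t - s) (x - y) * h s y ^ (2 : ℝ)
      ≤ (decayMass * A ^ (2 : ℝ) + M) *
        (ENNReal.ofReal (2 * t⁻¹) * ENNReal.ofReal ((t - s) ^ (-(1 / 2) : ℝ))) := by
  obtain ⟨hs0, hst⟩ := hs
  have ht : 0 < t := hs0.trans hst
  have hτ : 0 < t - s := sub_pos.2 hst
  rcases le_total (t / 2) s with h1 | h1
  · calc _ ≤ ∫⁻ y, decayKernel (t - s) (x - y) * (A ^ (2 : ℝ) * ENNReal.ofReal (2 * t⁻¹)) := by
          refine lintegral_mono fun y => ?_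
          gcongr
          calc h s y ^ (2 : ℝ) ≤ (A * ENNReal.ofReal (s ^ (-(1 / 2) : ℝ))) ^ (2 : ℝ) := by
                gcongr; exact hA s hs0 y
            _ = A ^ (2 : ℝ) * ENNReal.ofReal (s⁻¹) := by
                rw [ENNReal.mul_rpow_of_nonneg _ _ (by norm_num),
                  ENNReal.ofReal_rpow_of_pos (by positivity), ← Real.rpow_mul hs0.le,
                  ← Real.rpow_neg_one]
                norm_num
            _ ≤ _ := by
                gcongr
                rw [inv_le_comm₀ hs0 (by positivity), mul_inv, inv_inv]
                linarith
      _ = decayMass * A ^ (2 : ℝ) *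
        (ENNReal.ofReal (2 * t⁻¹) * ENNReal.ofReal ((t - s) ^ (-(1 / 2) : ℝ))) := by
          rw [lintegral_mul_const' _ _ (by finiteness),
            lintegral_sub_left_eq_self (fun y => decayKernel (t - s) y) x,
            lintegral_decayKernel hτ]
          ring
      _ ≤ _ := by gcongr; exact le_self_add
  · calc _ ≤ M * ENNReal.ofReal ((t - s) ^ (-(3 / 2) : ℝ)) := hM s hs0 x _ hτ
      _ ≤ M * (ENNReal.ofReal (2 * t⁻¹) * ENNReal.ofReal ((t - s) ^ (-(1 / 2) : ℝ))) := by
          gcongr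
          rw [← ENNReal.ofReal_mul (by positivity)]
          refine ENNReal.ofReal_le_ofReal ?_
          rw [show (-(3 / 2) : ℝ) = -1 + -(1 / 2) by norm_num, Real.rpow_add hτ, Real.rpow_neg_one]
          gcongr
          rw [inv_le_comm₀ hτ (by positivity), mul_inv, inv_inv]
          linarith
      _ ≤ _ := by gcongr; exact le_add_self

lemma quadMajorant_sup (hA : ∀ s, 0 < s → ∀ x, h s x ≤ A * ENNReal.ofReal (s ^ (-(1 / 2) : ℝ)))
    (hM : ∀ s, 0 < s → MorreyBound (h s) M) {t : ℝ} (ht : 0 < t) (x : E3) :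
    quadMajorant h t x ≤ (decayMass * A ^ (2 : ℝ) + M) * 4 *
      ENNReal.ofReal (t ^ (-(1 / 2) : ℝ)) := by
  have hmass := decayMass_lt_top.ne
  calc _ ≤ ∫⁻ s in Ioo 0 t, (decayMass * A ^ (2 : ℝ) + M) *
        (ENNReal.ofReal (2 * t⁻¹) * ENNReal.ofReal ((t - s) ^ (-(1 / 2) : ℝ))) :=
        setLIntegral_mono' measurableSet_Ioo fun s hs => lintegral_decay_sq_le hA hM hs x
    _ = (decayMass * A ^ (2 : ℝ) + M) * ENNReal.ofReal (2 * t⁻¹ * (2 * t ^ (1 / 2 : ℝ))) := by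
        rw [lintegral_const_mul' _ _ (by finiteness), lintegral_const_mul' _ _ (by finiteness),
          lintegral_sub_rpow_neg_half ht, ← ENNReal.ofReal_mul (by positivity)]
    _ = _ := by
        rw [show 2 * t⁻¹ * (2 * t ^ (1 / 2 : ℝ)) = 4 * (t ^ (-1 : ℝ) * t ^ (1 / 2 : ℝ)) by
          rw [Real.rpow_neg_one]; ring, ← Real.rpow_add ht, ENNReal.ofReal_mul (by norm_num),
          ENNReal.ofReal_ofNat, mul_assoc]
        norm_num

lemma quadMajorant_far (hM : ∀ s, 0 < s → MorreyBound (h s) M) {x₀ x : E3} {r ρ : ℝ}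
    (hrρ : r < ρ) {t : ℝ} (hx : x ∈ Metric.ball x₀ r) :
    quadMajorant (fun s => (Metric.ball x₀ ρ)ᶜ.indicator (h s)) t x
      ≤ 4 * M * ENNReal.ofReal (2 * ((ρ - r) ^ 2) ^ (-(1 / 2) : ℝ)) := by
  have hδ : 0 < ρ - r := sub_pos.2 hrρ
  calc _ ≤ ∫⁻ s in Ioo 0 t, 4 * M * ENNReal.ofReal ((t - s + (ρ - r) ^ 2) ^ (-(3 / 2) : ℝ)) :=
        setLIntegral_mono' measurableSet_Ioo fun s hs =>
          (hM s hs.1).far hrρ (sub_pos.2 hs.2) hx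
    _ ≤ _ := by
        rw [lintegral_const_mul' _ _ (by finiteness)]
        gcongr
        exact lintegral_shifted_le (by positivity)

lemma measurable_quad_integrand (hm : Measurable (Function.uncurry h)) (t : ℝ) (x : E3) :
    Measurable fun p : ℝ × E3 => decayKernel (t - p.1) (x - p.2) * h p.1 p.2 ^ (2 : ℝ) :=
  (measurable_decayKernel_comp (by fun_prop) (by fun_prop)).mul (hm.pow_const 2)

/-- The square splits without cross terms because the supports are disjoint. -/
lemma quadMajorant_split (hm : Measurable (Function.uncurry h)) {S : Set E3} (hS : MeasurableSet S)
    (t : ℝ) (x : E3) : quadMajorant h t x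
      = quadMajorant (fun s => S.indicator (h s)) t x
        + quadMajorant (fun s => Sᶜ.indicator (h s)) t x := by
  have hn : Measurable (Function.uncurry fun s => S.indicator (h s)) :=
    hm.indicator (measurable_snd hS)
  have hmn := measurable_quad_integrand hn t x
  rw [quadMajorant, quadMajorant, quadMajorant,
    ← lintegral_add_left hmn.lintegral_prod_right']
  refine lintegral_congr fun s => ?_
  have hms : Measurable fun y => decayKernel (t - s) (x - y) * S.indicator (h s) y ^ (2 : ℝ) :=
    hmn.comp (g := fun p : ℝ × E3 => _) (f := fun y => (s, y)) measurable_prodMk_left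
  refine Eq.trans (lintegral_congr fun y => ?_) (lintegral_add_left hms _)
  by_cases hy : y ∈ S <;> simp [hy]

end Majorant

/-! ### Bounds for the bilinear operator -/

section Bilinear

lemma measurable_leraySymbol (i j : Fin 3) : Measurable (leraySymbol i j) := by
  unfold leraySymbol; fun_prop

lemma measurable_oseenKernel (i j l : Fin 3) :
    Measurable (fun p : ℝ × E3 => oseenKernel i j l p.1 p.2) := by
  have h1 : Measurable (fun p : (ℝ × E3) × E3 =>
      Complex.exp (↑(2 * Real.pi * inner ℝ p.2 p.1.2) * Complex.I) •
        (heatSymbol p.1.1 p.2 * leraySymbol i j p.2 * derivSymbol l p.2)) := by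
    have h2 := measurable_leraySymbol i j
    have h3 : Measurable (derivSymbol l) := (hasTemperateGrowth_derivSymbol l).1.continuous.measurable
    unfold heatSymbol
    fun_prop
  have h4 := h1.stronglyMeasurable.integral_prod_right' (ν := (volume : Measure E3))
  simp only [oseenKernel, Real.fourierInv_eq']
  exact Complex.measurable_re.comp h4.measurable

lemma exists_enorm_oseenContract_le : ∃ C : ℝ≥0, ∀ τ, 0 < τ → ∀ z a : E3,
    ‖oseenContract τ z a a‖ₑ ≤ C * (decayKernel τ z * ‖a‖ₑ ^ (2 : ℝ)) := by
  obtain ⟨C, hC0, hC⟩ := exists_abs_oseenKernel_le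
  -- Nine pairs `(j,l)` per component, then `√3 ≤ 3` for the three components.
  refine ⟨(27 * C).toNNReal, fun τ hτ z a => ?_⟩
  set D := C * ((‖z‖ ^ 2 + τ) ^ 2)⁻¹ with hD
  have hD0 : 0 ≤ D := by positivity
  have hcomp : ∀ i, |∑ j, ∑ l, oseenKernel i j l τ z * a j * a l| ≤ 9 * (D * ‖a‖ ^ 2) := by
    intro i
    refine (Finset.abs_sum_le_sum_abs _ _).trans ?_
    calc _ ≤ ∑ j : Fin 3, ∑ l : Fin 3, D * ‖a‖ ^ 2 := by
          refine Finset.sum_le_sum fun j _ => (Finset.abs_sum_le_sum_abs _ _).trans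
            (Finset.sum_le_sum fun l _ => ?_)
          rw [abs_mul, abs_mul]
          calc _ ≤ D * ‖a‖ * ‖a‖ := by
                gcongr
                · exact hC i j l τ z hτ
                · exact abs_coord_le j a
                · exact abs_coord_le l a
            _ = _ := by ring
      _ = _ := by simp; ring
  have hnorm : ‖oseenContract τ z a a‖ ≤ 27 * (D * ‖a‖ ^ 2) := by
    rw [EuclideanSpace.norm_eq]
    refine Real.sqrt_le_iff.2 ⟨by positivity, ?_⟩
    calc ∑ i, ‖oseenContract τ z a a i‖ ^ 2 ≤ ∑ i : Fin 3, (9 * (D * ‖a‖ ^ 2)) ^ 2 := by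
          refine Finset.sum_le_sum fun i _ => ?_
          gcongr
          exact hcomp i
      _ ≤ _ := by
          simp
          nlinarith [sq_nonneg (D * ‖a‖ ^ 2)]
  rw [← ofReal_norm, ← ofReal_norm, decayKernel, ENNReal.ofReal_rpow_of_nonneg (norm_nonneg _)
    (by norm_num), ← ENNReal.ofReal_mul (by positivity), ← ENNReal.ofReal, ← ENNReal.ofReal_mul
    (by positivity)]
  refine ENNReal.ofReal_le_ofReal (hnorm.trans_eq ?_)
  rw [hD, Real.rpow_two]; ring

variable {v : ℝ → E3 → E3}

lemma measurable_duhamelIntegrand (hv : Measurable (Function.uncurry v)) :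
    Measurable (fun p : (ℝ × E3) × (ℝ × E3) => duhamelIntegrand v v p.1.1 p.1.2 p.2) := by
  unfold duhamelIntegrand oseenContract
  have hv2 : Measurable (fun p : (ℝ × E3) × (ℝ × E3) => v p.2.1 p.2.2) :=
    hv.comp measurable_snd
  refine (WithLp.measurable_toLp 2 (Fin 3 → ℝ)).comp (measurable_pi_lambda _ fun i => ?_)
  refine Finset.measurable_sum _ fun j _ => Finset.measurable_sum _ fun l _ => ?_
  have hk : Measurable (fun p : (ℝ × E3) × (ℝ × E3) =>
      oseenKernel i j l (p.1.1 - p.2.1) (p.1.2 - p.2.2)) :=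
    (measurable_oseenKernel i j l).comp
      (f := fun p : (ℝ × E3) × (ℝ × E3) => (p.1.1 - p.2.1, p.1.2 - p.2.2)) (by fun_prop)
  fun_prop

lemma measurable_bilinearB (hv : Measurable (Function.uncurry v)) :
    Measurable (Function.uncurry (bilinearB v v)) := by
  have h1 : Measurable (fun p : ((ℝ × E3) × ℝ) × E3 =>
      duhamelIntegrand v v p.1.1.1 p.1.1.2 (p.1.2, p.2)) :=
    (measurable_duhamelIntegrand hv).comp
      (f := fun p : ((ℝ × E3) × ℝ) × E3 => (p.1.1, (p.1.2, p.2))) (by fun_prop)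
  have h2 := h1.stronglyMeasurable.integral_prod_right' (ν := (volume : Measure E3))
  -- The domain of integration depends on `t`, so it enters as an indicator jointly measurable in
  -- `(t,x,s)`.
  have hset : MeasurableSet {p : (ℝ × E3) × ℝ | p.2 ∈ Ioo 0 p.1.1} :=
    (measurableSet_lt measurable_const measurable_snd).inter
      (measurableSet_lt measurable_snd (by fun_prop))
  have h3 := (h2.indicator hset).integral_prod_right' (ν := (volume : Measure ℝ))
  convert h3.measurable using 1
  ext1 p
  rw [Function.uncurry, bilinearB, ← integral_indicator measurableSet_Ioo]
  rfl

lemma setLIntegral_duhamel_le : ∃ C : ℝ≥0, ∀ v : ℝ → E3 → E3, ∀ t x,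
    ∫⁻ s in Ioo 0 t, ∫⁻ y, ‖duhamelIntegrand v v t x (s, y)‖ₑ
      ≤ C * quadMajorant (fun s y => ‖v s y‖ₑ) t x := by
  obtain ⟨C, hC⟩ := exists_enorm_oseenContract_le
  refine ⟨C, fun v t x => ?_⟩
  rw [quadMajorant, ← lintegral_const_mul' _ _ ENNReal.coe_ne_top]
  refine setLIntegral_mono' measurableSet_Ioo fun s hs => ?_
  rw [← lintegral_const_mul' _ _ ENNReal.coe_ne_top]
  exact lintegral_mono fun y => hC _ (sub_pos.2 hs.2) _ _

lemma exists_enorm_bilinearB_le : ∃ C : ℝ≥0, ∀ v : ℝ → E3 → E3, ∀ t x,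
    ‖bilinearB v v t x‖ₑ ≤ C * quadMajorant (fun s y => ‖v s y‖ₑ) t x := by
  obtain ⟨C, hC⟩ := setLIntegral_duhamel_le
  refine ⟨C, fun v t x => le_trans ?_ (hC v t x)⟩
  exact (enorm_integral_le_lintegral_enorm _).trans
    (lintegral_mono fun s => enorm_integral_le_lintegral_enorm _)

/-- Absolute convergence at every point follows from the finite pointwise bound on the quadratic
majorant. -/
lemma CriticalBound.integrableOn_duhamel (hv : CriticalBound v) {t : ℝ} (ht : 0 < t) (x : E3) :
    IntegrableOn (duhamelIntegrand v v t x) (Ioo 0 t ×ˢ univ) := by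
  obtain ⟨A, hA⟩ := hv.sup
  obtain ⟨M, hM⟩ := hv.morrey
  obtain ⟨C, hC⟩ := setLIntegral_duhamel_le
  have hmass := decayMass_lt_top.ne
  have hm : Measurable (duhamelIntegrand v v t x) :=
    (measurable_duhamelIntegrand hv.meas).comp (f := fun p : ℝ × E3 => ((t, x), p)) (by fun_prop)
  refine ⟨hm.aestronglyMeasurable, ?_⟩
  rw [HasFiniteIntegral, Measure.volume_eq_prod, ← Measure.prod_restrict, Measure.restrict_univ,
    lintegral_prod _ hm.enorm.aemeasurable]
  refine ((hC v t x).trans (mul_le_mul' le_rfl (quadMajorant_sup hA hM ht x))).trans_lt ?_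
  finiteness

lemma MorreyBound.const_mul {h : E3 → ℝ≥0∞} {M : ℝ≥0∞} (hh : MorreyBound h M) (c : ℝ≥0) :
    MorreyBound (fun y => c * h y) (c ^ (2 : ℝ) * M) := by
  intro x σ hσ
  calc _ = ∫⁻ y, (c : ℝ≥0∞) ^ (2 : ℝ) * (decayKernel σ (x - y) * h y ^ (2 : ℝ)) := by
        refine lintegral_congr fun y => ?_
        rw [ENNReal.mul_rpow_of_nonneg _ _ (by norm_num)]; ring
    _ ≤ _ := by
        rw [lintegral_const_mul' _ _ (by finiteness), mul_assoc]
        gcongr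
        exact hh x σ hσ

lemma CriticalBound.bilinearB (hv : CriticalBound v) :
    CriticalBound (PicardNS.bilinearB v v) := by
  obtain ⟨A, hA⟩ := hv.sup
  obtain ⟨M, hM⟩ := hv.morrey
  obtain ⟨C, hC⟩ := exists_enorm_bilinearB_le
  have hmass := decayMass_lt_top.ne
  refine ⟨measurable_bilinearB hv.meas,
    ⟨(C * ((decayMass * A ^ (2 : ℝ) + M) * 4)).toNNReal, fun t ht x => ?_⟩,
    ⟨(C ^ (2 : ℝ) * ((8 * decayMass) ^ (2 : ℝ) * (A ^ (2 : ℝ) * M))).toNNReal, fun t ht => ?_⟩⟩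
  · rw [ENNReal.coe_toNNReal (by finiteness), mul_assoc (C : ℝ≥0∞)]
    exact (hC v t x).trans (mul_le_mul' le_rfl (quadMajorant_sup hA hM ht x))
  · rw [ENNReal.coe_toNNReal (by finiteness)]
    exact ((morreyBound_quadMajorant (h := fun s y => ‖v s y‖ₑ) hv.meas.enorm hA hM ht).const_mul C).mono (hC v t)

/-- The near part, cut off to the larger ball, is linearised and averaged in `L^q`; the far part
needs only the Morrey bound and the gap `ρ - r`. -/
lemma CriticalBound.uniformLq_bilinearB (hv : CriticalBound v) {q : ℝ≥0∞} (hq : 1 ≤ q) {x₀ : E3}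
    {r ρ : ℝ} (hrρ : r < ρ) (hloc : UniformLq v q (Metric.ball x₀ ρ)) :
    UniformLq (PicardNS.bilinearB v v) q (Metric.ball x₀ r) := by
  obtain ⟨A, hA⟩ := hv.sup
  obtain ⟨M, hM⟩ := hv.morrey
  obtain ⟨C, hC⟩ := exists_enorm_bilinearB_le
  obtain ⟨L, hL⟩ := hloc
  have hmass := decayMass_lt_top.ne
  set S := Metric.ball x₀ ρ with hS
  have hSm : MeasurableSet S := Metric.isOpen_ball.measurableSet
  set K : ℝ≥0∞ := C * (4 * M * ENNReal.ofReal (2 * ((ρ - r) ^ 2) ^ (-(1 / 2) : ℝ))) with hKdef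
  have hKS := eLpNorm_const_ball_ne_top (K := K) (by finiteness) q x₀ r
  set near : ℝ → E3 → ℝ≥0∞ := fun s => S.indicator fun y => ‖v s y‖ₑ with hnear
  have hnm : Measurable (Function.uncurry near) := hv.meas.enorm.indicator (measurable_snd hSm)
  have hnA : ∀ s, 0 < s → ∀ x, near s x ≤ A * ENNReal.ofReal (s ^ (-(1 / 2) : ℝ)) :=
    fun s hs x => (indicator_le_self _ _ x).trans (hA s hs x)
  refine ⟨(8 * decayMass * (C * A * L) +
    eLpNorm (fun _ : E3 => K) q (volume.restrict (Metric.ball x₀ r))).toNNReal, fun t ht => ?_⟩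
  rw [ENNReal.coe_toNNReal (by finiteness)]
  refine (eLpNorm_le_of_superposition (ν := duhamelMajorant t) (ζ := Prod.snd)
    (h := fun p y => (C * A : ℝ≥0) • near p.1 y) (C := C * A * L) (K := K)
    ((hnm.comp (f := fun p : (ℝ × E3) × E3 => (p.1.1, p.2)) (by fun_prop)).const_smul _)
    measurable_snd hq ?_ fun x hx => (hC v t x).trans ?_).trans ?_
  · filter_upwards [ae_duhamelMajorant t] with p hp
    have hb : eLpNorm (near p.1) q volume ≤ L := by
      rw [hnear, eLpNorm_indicator_eq_eLpNorm_restrict hSm, eLpNorm_enorm]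
      exact hL p.1 hp
    refine (eLpNorm_le_nnreal_smul_eLpNorm_of_ae_le_mul' (f := fun y => (C * A : ℝ≥0) • near p.1 y)
      (g := near p.1) (c := C * A) (.of_forall fun y => ?_) q).trans ?_
    · simp [ENNReal.smul_def]
    · rw [ENNReal.smul_def, smul_eq_mul]
      push_cast
      gcongr
  · rw [quadMajorant_split (h := fun s y => ‖v s y‖ₑ) hv.meas.enorm hSm, mul_add]
    refine add_le_add ?_ (mul_le_mul' le_rfl (quadMajorant_far hM hrρ hx))
    refine (mul_le_mul' le_rfl (quadMajorant_le hnm hnA t x)).trans_eq ?_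
    rw [← lintegral_const_mul' _ _ ENNReal.coe_ne_top]
    refine lintegral_congr fun p => ?_
    rw [ENNReal.smul_def, smul_eq_mul, ENNReal.coe_mul, mul_assoc]
  · gcongr
    exact duhamelMajorant_univ_le ht

end Bilinear

/-! ### Induction on the iterates and almost-everywhere representatives -/

section Picard

variable {u : E3 → E3} {M : ℝ≥0}

lemma criticalBound_picard (hu : Measurable u) (hM : MorreyBound (fun y => ‖u y‖ₑ) M) (k : ℕ) :
    CriticalBound (picard u k) := by
  induction k with
  | zero => exact criticalBound_heatFlow hu hM
  | succ k ih => exact (criticalBound_heatFlow hu hM).sub ih.bilinearB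

lemma uniformLq_picard (hu : Measurable u) (hM : MorreyBound (fun y => ‖u y‖ₑ) M)
    {q : ℝ≥0∞} (hq : 1 ≤ q) {x₀ : E3} {R : ℝ}
    (hloc : MemLp u q (volume.restrict (Metric.ball x₀ R))) (k : ℕ) :
    ∀ r, r < R → UniformLq (picard u k) q (Metric.ball x₀ r) := by
  induction k with
  | zero => exact fun r hr => uniformLq_heatFlow hu hM hq hr hloc
  | succ k ih =>
    intro r hr
    have hP := criticalBound_picard hu hM k
    exact (uniformLq_heatFlow hu hM hq hr hloc).sub hq (measurable_heatFlow hu)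
      (measurable_bilinearB hP.meas)
      -- The previous iterate is used on the intermediate radius `(r+R)/2`.
      (hP.uniformLq_bilinearB hq (left_lt_add_div_two.2 hr) (ih _ (add_div_two_lt_right.2 hr)))

lemma UniformLq.memLinftyLq {v : ℝ → E3 → E3} {q : ℝ≥0∞} {S : Set E3}
    (hv : Measurable (Function.uncurry v)) (h : UniformLq v q S) : MemLinftyLq v q S := by
  obtain ⟨C, hC⟩ := h
  refine ⟨hv.aestronglyMeasurable, (essSup_le_of_ae_le (C : ℝ≥0∞) ?_).trans_lt ENNReal.coe_lt_top⟩
  filter_upwards [ae_restrict_mem measurableSet_Ioi] with t ht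
  exact hC t ht

lemma weakLpNorm_congr {u w : E3 → E3} (h : u =ᵐ[volume] w) (p : ℝ) :
    weakLpNorm u p volume = weakLpNorm w p volume := by
  unfold weakLpNorm
  refine iSup_congr fun a => ?_
  have hS : {x | (a : ℝ) < ‖u x‖} =ᵐ[volume] {x | (a : ℝ) < ‖w x‖} := by
    filter_upwards [h] with x hx
    change ((a : ℝ) < ‖u x‖) = ((a : ℝ) < ‖w x‖)
    rw [hx]
  rw [measure_congr hS]

lemma heatFlow_congr {u w : E3 → E3} (h : u =ᵐ[volume] w) : heatFlow u = heatFlow w := by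
  ext1 t
  ext1 x
  refine integral_congr_ae ?_
  filter_upwards [h] with y hy
  rw [hy]

/-- The data enter only through integrals, so the iterates agree everywhere, not merely almost
everywhere. -/
lemma picard_congr {u w : E3 → E3} (h : u =ᵐ[volume] w) (k : ℕ) : picard u k = picard w k := by
  induction k with
  | zero => exact heatFlow_congr h
  | succ k ih => simp only [picard, ih, heatFlow_congr h]

end Picard

end PicardNS

end

theorem mainTheorem4 (x₀ : PicardNS.E3) (r R : ℝ) (hr : 0 < r) (hrR : r < R)
    (u₀ : PicardNS.E3 → PicardNS.E3) (hu₀ : PicardNS.MemWeakLp u₀ 3 volume)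
    (q : ℝ≥0∞) (hq : 3 < q)
    (hloc : MemLp u₀ q (volume.restrict (Metric.ball x₀ R))) (k : ℕ) :
    PicardNS.PicardConverges u₀ k ∧
      PicardNS.MemLinftyLq (PicardNS.picard u₀ k) q (Metric.ball x₀ r) := by
  obtain ⟨hum, hW⟩ := hu₀
  have hae := hum.ae_eq_mk
  -- A Borel representative makes all joint measurability statements available.
  set u := hum.mk u₀
  have hu : Measurable u := hum.stronglyMeasurable_mk.measurable
  rw [PicardNS.weakLpNorm_congr hae] at hW
  have hq1 : 1 ≤ q := le_trans (by norm_num) hq.le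
  have hloc' : MemLp u q (volume.restrict (Metric.ball x₀ R)) :=
    hloc.ae_eq (ae_restrict_of_ae hae)
  have hmass := PicardNS.decayMass_lt_top.ne
  have hM := PicardNS.morreyBound_of_weakLp hu
  rw [← ENNReal.coe_toNNReal (a := 2 * (_ + _)) (by finiteness)] at hM
  refine ⟨⟨fun t ht x => ?_, fun j _ t ht x => ?_⟩, ?_⟩
  · refine (PicardNS.integrable_heatKernel hu hM ht x).congr ?_
    filter_upwards [hae] with y hy
    rw [hy]
  · rw [PicardNS.picard_congr hae]
    exact (PicardNS.criticalBound_picard hu hM j).integrableOn_duhamel ht x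
  · rw [PicardNS.picard_congr hae]
    exact (PicardNS.uniformLq_picard hu hM hq1 hloc' k r hrR).memLinftyLq
      (PicardNS.criticalBound_picard hu hM k).meas
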